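/- Let $K$ be a field of characteristic $0$, complete with respect to a non-trivial non-archimedean absolute value $|\cdot|$, and let $p\ge 0$ be its residue characteristic. Put $\omega(K)=|p|^{1/(p-1)}$ if $p>0$ and $\omega(K)=1$ if $p=0$. For a self-map $f$ of a nonzero vector space $X$ with an ultrametric norm $|\cdot|$, put $|f|_{op}=\sup_{x\ne 0}|f(x)|/|x|$ and $|f|_{sp}=\inf_{i\ge 1}|f^i|_{op}^{1/i}$. Let $(\partial_j)_{j\in J}$, $J\neq\emptyset$, be a family of pairwise commuting, nonzero, bounded derivations of $K$ (bounded: $|\partial_j|_{op}<\infty$), and put $r(K,\partial_j)=\omega(K)/|\partial_j|_{sp,K}$. Let $V$ be a finite differential module over $K$: a finite-dimensional $K$-vector space with pairwise commuting additive maps $D_j:V\to V$ $(j\in J)$ such that $D_j(cv)=\partial_j(c)v+cD_j(v)$ for $c\in K$, $v\in V$. For a subspace $N\subseteq V$ stable under $D_j$, the extrinsic subsidiary $\partial_j$-generic radii of $N$ are the multiset obtained from a Jordan–Hölder series of $N$, viewed as a module with the single operator $D_j$, by taking for each irreducible factor $W$ the number $\omega(K)/|D_j|_{sp,W}$ with multiplicity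 $\dim_K W$ (the spectral norm being taken with respect to any ultrametric $K$-norm on $W$). For every $r_J=(r_j)_{j\in J}\in\prod_{j\in J}(0,r(K,\partial_j)]$ there is a largest subspace $V_{r_J}$ of $V$ that is stable under all $D_j$ and such that, for every $j\in J$, all extrinsic subsidiary $\partial_j$-generic radii of $V_{r_J}$ are equal to $r_j$. Moreover: 1. There are only finitely many $r_J\in\prod_{j\in J}(0,r(K,\partial_j)]$ with $V_{r_J}\neq 0$. 2. The natural map $\bigoplus_{r_J\in\prod_{j\in J}(0,r(K,\partial_j)]}V_{r_J}\to V$ is an isomorphism. -/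

import Mathlib

noncomputable section

namespace NonarchDiff

section Norms

/-- Operator norm of a self-map `f` with respect to a norm function `ν`:
the supremum of `ν (f x) / ν x` over `x ≠ 0`. -/
def opNorm {X : Type*} [Zero X] (ν : X → ℝ) (f : X → X) : ℝ :=
  sSup {t : ℝ | ∃ x : X, x ≠ 0 ∧ t = ν (f x) / ν x}

/-- Spectral norm of a self-map `f` with respect to a norm function `ν`:
the infimum over `i ≥ 1` of the `i`-th root of the operator norm of the `i`-th iterate. -/
def spectralOpNorm {X : Type*} [Zero X] (ν : X → ℝ) (f : X → X) : ℝ :=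
  sInf {t : ℝ | ∃ i : ℕ, 1 ≤ i ∧ t = opNorm ν (f^[i]) ^ ((1 : ℝ) / (i : ℝ))}

end Norms

section Field

variable (K : Type*) [NontriviallyNormedField K] [IsUltrametricDist K]

/-- The characteristic of the residue field of the valuation ring `{x | ‖x‖ ≤ 1}`. -/
def residueChar : ℕ :=
  ringChar (IsLocalRing.ResidueField (NormedField.valuation (K := K)).valuationSubring)

/-- `ω(K) = |p| ^ (1 / (p - 1))` if the residue characteristic `p` is positive, and `1` if it
is zero. -/
def omega : ℝ :=
  if residueChar K = 0 then 1
  else ‖(residueChar K : K)‖ ^ ((1 : ℝ) / ((residueChar K : ℝ) - 1))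

variable {K}

/-- A bounded derivation: one with finite operator norm. -/
def IsBoundedDerivation (d : Derivation ℤ K K) : Prop :=
  ∃ C : ℝ, ∀ x : K, ‖d x‖ ≤ C * ‖x‖

/-- `r(K, d) = ω(K) / |d|_{sp,K}`. -/
def fieldRadius (d : Derivation ℤ K K) : ℝ :=
  omega K / spectralOpNorm (fun x : K => ‖x‖) (fun x : K => d x)

end Field

/-- A differential operator relative to the derivation `d` on a `K`-vector space. -/
structure DiffOp {K : Type*} [Field K] (d : Derivation ℤ K K)
    (V : Type*) [AddCommGroup V] [Module K V] extends V →+ V where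
  leibniz' : ∀ (c : K) (v : V), toFun (c • v) = d c • v + c • toFun v

namespace DiffOp

section Algebra

variable {K : Type*} [Field K] {d : Derivation ℤ K K}
  {V : Type*} [AddCommGroup V] [Module K V]

instance : CoeFun (DiffOp d V) (fun _ => V → V) := ⟨fun D => D.toAddMonoidHom⟩

/-- `N` is stable under `D`. -/
def Stable (D : DiffOp d V) (N : Submodule K V) : Prop := ∀ v ∈ N, D v ∈ N

/-- The operator induced on a stable subspace. -/
def restrict (D : DiffOp d V) (N : Submodule K V) (hN : D.Stable N) : DiffOp d N where
  toFun v := ⟨D v, hN v v.2⟩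
  map_zero' := Subtype.ext D.map_zero
  map_add' v w := Subtype.ext (D.map_add v w)
  leibniz' c v := Subtype.ext (D.leibniz' c v)

/-- The operator induced on the quotient by a stable subspace. -/
def quotient (D : DiffOp d V) (N : Submodule K V) (hN : D.Stable N) : DiffOp d (V ⧸ N) where
  toFun := Quotient.map' D (fun a b h => by
    rw [Submodule.quotientRel_def] at h ⊢
    have h2 := hN _ h
    rwa [show D (a - b) = D a - D b from D.toAddMonoidHom.map_sub a b] at h2)
  map_zero' := congrArg (Submodule.Quotient.mk (p := N)) D.map_zero
  map_add' v w := by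
    induction v using Submodule.Quotient.induction_on with | _ v
    induction w using Submodule.Quotient.induction_on with | _ w
    exact congrArg (Submodule.Quotient.mk (p := N)) (D.map_add v w)
  leibniz' c v := by
    induction v using Submodule.Quotient.induction_on with | _ v
    exact congrArg (Submodule.Quotient.mk (p := N)) (D.leibniz' c v)

/-- The differential submodules of `(V, D)`, ordered by inclusion. -/
abbrev StableSubmodule (D : DiffOp d V) : Type _ := {N : Submodule K V // D.Stable N}

instance (D : DiffOp d V) : BoundedOrder (StableSubmodule D) where
  top := ⟨⊤, fun _ _ => Submodule.mem_top⟩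
  le_top _ := fun _ _ => Submodule.mem_top
  bot := ⟨⊥, fun v hv => by
    rw [Submodule.mem_bot] at hv ⊢
    rw [hv]
    exact D.map_zero⟩
  bot_le _ := by
    intro v hv
    rw [(Submodule.mem_bot K).1 hv]
    exact Submodule.zero_mem _

/-- The operator induced on the subquotient `B / (A ∩ B)`, which is `B / A` when `A ≤ B`. -/
def subquotient (D : DiffOp d V) (A B : StableSubmodule D) :
    DiffOp d (↥B.1 ⧸ A.1.submoduleOf B.1) :=
  (D.restrict B.1 B.2).quotient (A.1.submoduleOf B.1) (fun v hv => A.2 v.1 hv)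

end Algebra

section Radii

variable {K : Type*} [NontriviallyNormedField K] [IsUltrametricDist K] {d : Derivation ℤ K K}
  {V : Type*} [AddCommGroup V] [Module K V] [FiniteDimensional K V]

variable (K) in
/-- An ultrametric norm on a finite-dimensional space: the maximum of the absolute values of the
coordinates in some basis. (Over a complete field the spectral norm of a differential operator
does not depend on the norm, all norms being equivalent.) -/
def coordNorm (W : Type*) [AddCommGroup W] [Module K W] [FiniteDimensional K W] (w : W) : ℝ :=
  ‖(Module.finBasis K W).equivFun w‖

/-- `ω(K) / |D|_{sp,V}`, the extrinsic generic radius of convergence. -/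
def genericRadius (D : DiffOp d V) : ℝ :=
  omega K / spectralOpNorm (coordNorm K V) (fun v => D v)

/-- A Jordan-Hölder series of `(V, D)`: a finite chain of differential submodules from `0` to `V`
in which each step is a covering, that is, has an irreducible quotient. -/
structure JHSeries (D : DiffOp d V) where
  series : RelSeries {(A, B) : StableSubmodule D × StableSubmodule D | A ⋖ B}
  head_eq : series.head = ⊥
  last_eq : series.last = ⊤

instance (D : DiffOp d V) : Nonempty (JHSeries D) := by
  have h1 : WellFoundedLT (StableSubmodule D) := inferInstance
  have h2 : WellFoundedGT (StableSubmodule D) := inferInstance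
  obtain ⟨s, -, -, hs, ht⟩ :=
    LTSeries.exists_relSeries_covBy_and_head_eq_bot_and_last_eq_bot
      (RelSeries.singleton _ (⊥ : StableSubmodule D))
  exact ⟨⟨s, hs, ht⟩⟩

/-- The radii attached to a Jordan-Hölder series: the generic radius of each factor, repeated as
often as the dimension of the factor. -/
def JHSeries.radii {D : DiffOp d V} (s : JHSeries D) : Multiset ℝ :=
  ∑ i : Fin s.series.length,
    Multiset.replicate
      (Module.finrank K
        (↥(s.series i.succ).1 ⧸ (s.series i.castSucc).1.submoduleOf (s.series i.succ).1))
      (D.subquotient (s.series i.castSucc) (s.series i.succ)).genericRadius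

/-- The multiset of extrinsic subsidiary generic radii of `(V, D)`, computed from some
Jordan-Hölder series. (By the Jordan-Hölder theorem the choice of the series is immaterial.) -/
def subsidiaryRadii (D : DiffOp d V) : Multiset ℝ :=
  (Classical.arbitrary (JHSeries D)).radii

end Radii

end DiffOp

section Family

variable {K : Type*} [NontriviallyNormedField K] [IsUltrametricDist K]
  {J : Type*} {d : J → Derivation ℤ K K}
  {V : Type*} [AddCommGroup V] [Module K V] [FiniteDimensional K V]

/-- `N` is a differential submodule (stable under all `D j`) and, for every `j`, its extrinsic
subsidiary generic radii relative to `d j` are all equal to `r j`. -/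
def IsPure (D : ∀ j, DiffOp (d j) V) (r : J → ℝ) (N : Submodule K V) : Prop :=
  ∀ j, ∃ hN : (D j).Stable N, ∀ s ∈ ((D j).restrict N hN).subsidiaryRadii, s = r j

/-- The subspace `V_r`: the span of all differential submodules whose subsidiary radii relative to
`d j` are all equal to `r j`, for every `j`. -/
def component (D : ∀ j, DiffOp (d j) V) (r : J → ℝ) : Submodule K V :=
  sSup {N | IsPure D r N}

end Family

end NonarchDiff

end

noncomputable section

set_option linter.unusedSectionVars false

namespace NonarchDiff

open DiffOp

/-! Fix one operator `D` and a rate `s > 0`, and call a module slow if the iterates of `D` grow at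
most like `s ^ n` (`Bdd`). Slowness passes to submodules, quotients and extensions, and to duals
once the derivation itself grows at most like `s ^ n`, which holds as soon as some nonzero module is
slow. Hence `V` has a stable `T` with `V / T` slow and without nonzero slow quotients of its own.

The heart of the proof is that `T` then has a slow complement. In a module without slow quotients,
the vectors that are combinations of the `D ^ i e_j` with coefficients `b` making all `|b| s ^ i`
arbitrarily small form a stable subspace with slow quotient, so they are everything
(`NoQuot.mem_weightedBall`). Such expansions of a basis, moved across a pairing with a slow module,
give a contraction, and the fixed point theorem makes `h ↦ D' h - h D` surjective on maps from a
slow module to one without slow quotients (`NoQuot.pairing_mem`, `NoQuot.commutator_surjective`).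
This splits the extension (`NoQuot.exists_isCompl`).

Splitting and duality show that having no slow quotient is the same as having no slow submodule
(`noSub_iff_noQuot`). So there are no nonzero morphisms between the two pieces in either direction,
and every operator commuting with `D` preserves both (`stable_of_commute_of_isCompl`).

Cutting `V` in this way for all `D j` and all rates ends, by induction on the dimension, in pieces
that are pure for every `j`. Modules pure of different rates share no nonzero subquotient, so the
components are independent, and finite dimension leaves only finitely many nonzero ones. Purity is
the statement about Jordan-Hölder factors by `forall_subsidiaryRadii_iff`; the radii fall in the
prescribed intervals because a nonzero derivation has positive spectral norm
(`spectralOpNorm_derivation_pos`). -/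

/-- The iterates of `f` grow at most like `s ^ n`, uniformly with respect to `ν`. -/
def GrowthLE {X : Type*} (ν : X → ℝ) (f : X → X) (s : ℝ) : Prop :=
  ∃ C : ℝ, 0 ≤ C ∧ ∀ n x, ν (f^[n] x) ≤ C * s ^ n * ν x

lemma GrowthLE.mono {X : Type*} {ν : X → ℝ} (hν : ∀ x, 0 ≤ ν x) {f : X → X} {s t : ℝ}
    (hs : 0 ≤ s) (hst : s ≤ t) (h : GrowthLE ν f s) : GrowthLE ν f t := by
  obtain ⟨C, hC, h⟩ := h
  refine ⟨C, hC, fun n x => (h n x).trans ?_⟩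
  have := hν x
  gcongr

/-! ### Coordinate norms and boundedness of linear maps. -/

section CoordNorm

variable {K : Type*} [NontriviallyNormedField K]
  {V : Type*} [AddCommGroup V] [Module K V] [FiniteDimensional K V]
  {W : Type*} [AddCommGroup W] [Module K W] [FiniteDimensional K W]

lemma coordNorm_nonneg (v : V) : 0 ≤ coordNorm K V v := norm_nonneg _

@[simp] lemma coordNorm_zero : coordNorm K V 0 = 0 := by simp [coordNorm]

lemma coordNorm_eq_zero {v : V} : coordNorm K V v = 0 ↔ v = 0 := by simp [coordNorm]

@[simp] lemma coordNorm_neg (v : V) : coordNorm K V (-v) = coordNorm K V v := by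
  simp only [coordNorm, map_neg, norm_neg]

lemma coordNorm_smul (c : K) (v : V) : coordNorm K V (c • v) = ‖c‖ * coordNorm K V v := by
  simp only [coordNorm, map_smul, norm_smul]

lemma norm_finBasis_coord_le (v : V) (i) :
    ‖(Module.finBasis K V).equivFun v i‖ ≤ coordNorm K V v := norm_le_pi_norm _ i

variable [IsUltrametricDist K]

lemma coordNorm_add_le_max (v w : V) :
    coordNorm K V (v + w) ≤ max (coordNorm K V v) (coordNorm K V w) := by
  simp only [coordNorm, map_add]
  exact IsUltrametricDist.norm_add_le_max _ _

lemma coordNorm_sub_le_max (v w : V) :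
    coordNorm K V (v - w) ≤ max (coordNorm K V v) (coordNorm K V w) := by
  simpa [sub_eq_add_neg] using coordNorm_add_le_max (K := K) v (-w)

lemma coordNorm_add_le {v w : V} {c : ℝ} (hv : coordNorm K V v ≤ c) (hw : coordNorm K V w ≤ c) :
    coordNorm K V (v + w) ≤ c :=
  (coordNorm_add_le_max v w).trans (max_le hv hw)

lemma coordNorm_sub_le {v w : V} {c : ℝ} (hv : coordNorm K V v ≤ c) (hw : coordNorm K V w ≤ c) :
    coordNorm K V (v - w) ≤ c :=
  (coordNorm_sub_le_max v w).trans (max_le hv hw)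

lemma coordNorm_sum_le {ι : Type*} (t : Finset ι) (f : ι → V) {c : ℝ} (hc : 0 ≤ c)
    (h : ∀ i ∈ t, coordNorm K V (f i) ≤ c) : coordNorm K V (∑ i ∈ t, f i) ≤ c := by
  classical
  induction t using Finset.induction_on with
  | empty => simpa using hc
  | insert a t ha ih =>
    rw [Finset.sum_insert ha]
    exact coordNorm_add_le (h a (by simp)) (ih fun i hi => h i (by simp [hi]))

/-- An additive map which is bounded on scalar multiples of the basis vectors is bounded. -/
lemma exists_coordNorm_le_of_basis (f : V → W) (hadd : ∀ (t : Finset (Fin (Module.finrank K V)))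
      (g : Fin (Module.finrank K V) → V), f (∑ i ∈ t, g i) = ∑ i ∈ t, f (g i))
    (h : ∀ v : V, ∃ C : ℝ, ∀ c : K, coordNorm K W (f (c • v)) ≤ C * ‖c‖) :
    ∃ C : ℝ, 0 ≤ C ∧ ∀ v, coordNorm K W (f v) ≤ C * coordNorm K V v := by
  choose C hC using h
  set b := Module.finBasis K V
  refine ⟨∑ i, |C (b i)|, Finset.sum_nonneg fun _ _ => abs_nonneg _, fun v => ?_⟩
  have hv : v = ∑ i, b.equivFun v i • b i := (b.sum_equivFun v).symm
  have h0 := coordNorm_nonneg (K := K) v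
  conv_lhs => rw [hv, hadd]
  refine coordNorm_sum_le _ _ (by positivity) fun i _ => (hC _ _).trans ?_
  have h1 := norm_finBasis_coord_le (K := K) v i
  calc C (b i) * ‖b.equivFun v i‖ ≤ |C (b i)| * ‖b.equivFun v i‖ := by
        gcongr; exact le_abs_self _
    _ ≤ (∑ i, |C (b i)|) * coordNorm K V v := by
        gcongr
        exact Finset.single_le_sum (f := fun i => |C (b i)|) (fun _ _ => abs_nonneg _)
          (Finset.mem_univ i)

lemma exists_coordNorm_map_le (f : V →ₗ[K] W) :
    ∃ C : ℝ, 0 ≤ C ∧ ∀ v, coordNorm K W (f v) ≤ C * coordNorm K V v :=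
  exists_coordNorm_le_of_basis f (fun t g => map_sum f g t) fun v =>
    ⟨coordNorm K W (f v), fun c => by rw [map_smul, coordNorm_smul, mul_comm]⟩

lemma exists_norm_map_le (f : V →ₗ[K] K) :
    ∃ C : ℝ, 0 ≤ C ∧ ∀ v, ‖f v‖ ≤ C * coordNorm K V v := by
  obtain ⟨C, hC, h⟩ := exists_coordNorm_map_le f
  have h1 : 0 < coordNorm K K (1 : K) :=
    (coordNorm_nonneg _).lt_of_ne fun h => one_ne_zero (coordNorm_eq_zero.1 h.symm)
  refine ⟨C / coordNorm K K (1 : K), by positivity, fun v => ?_⟩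
  have h2 := h v
  rw [← mul_one (f v), ← smul_eq_mul, coordNorm_smul] at h2
  rw [div_mul_eq_mul_div, le_div_iff₀ h1]
  exact h2

/-- A bounded injective linear map is bounded below. -/
lemma exists_coordNorm_le_of_injective (f : V →ₗ[K] W) (hf : Function.Injective f) :
    ∃ C : ℝ, 0 ≤ C ∧ ∀ v, coordNorm K V v ≤ C * coordNorm K W (f v) := by
  obtain ⟨g, hg⟩ := f.exists_leftInverse_of_injective (LinearMap.ker_eq_bot.2 hf)
  obtain ⟨C, hC, h⟩ := exists_coordNorm_map_le g
  refine ⟨C, hC, fun v => ?_⟩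
  have := h (f v)
  rwa [show g (f v) = v from LinearMap.congr_fun hg v] at this

end CoordNorm

/-! ### Growth of iterates under splittings and pairings. -/

/-- A growth bound for an operator `D` which, up to a bounded error `D ρ - ρ D` with values in
`N`, is controlled on the image of `ρ` and on the subset `N` containing all `v - ρ v`. -/
lemma growthLE_of_splitting {V : Type*} [AddCommGroup V] {ν κ : V → ℝ}
    (hν : ∀ v, 0 ≤ ν v)
    (hadd : ∀ (x y : V) (c : ℝ), ν x ≤ c → ν y ≤ c → ν (x + y) ≤ c)
    (hsub : ∀ (x y : V) (c : ℝ), ν x ≤ c → ν y ≤ c → ν (x - y) ≤ c)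
    (D : V →+ V) (N : Set V) (ρ : V → V) {s a P b S Q : ℝ} (hs : 0 < s)
    (ha : 0 ≤ a) (hS : 0 ≤ S) (hQ : 0 ≤ Q)
    (hN : ∀ k, ∀ w ∈ N, ν (D^[k] w) ≤ a * s ^ k * ν w)
    (hκP : ∀ v, κ v ≤ P * ν v) (hκ : ∀ n v, κ (D^[n] v) ≤ b * s ^ n * ν v)
    (hρN : ∀ v, v - ρ v ∈ N) (hρ : ∀ v, ν (ρ v) ≤ S * κ v)
    (hδN : ∀ v, D (ρ v) - ρ (D v) ∈ N) (hδ : ∀ v, ν (D (ρ v) - ρ (D v)) ≤ Q * κ v) :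
    GrowthLE ν D s := by
  -- The first entry serves `n = 0`, the second the error added at each step, where `1 / s` makes up
  -- for a missing power of `s`. Since sums are bounded by maxima, one `C` serves all `n`.
  set C := max (a * max 1 (S * P)) (a * Q * b / s) with hCdef
  have hC : 0 ≤ C := le_max_of_le_left (by positivity)
  have key : ∀ n k v, ν (D^[k] (D^[n] v - ρ (D^[n] v))) ≤ C * s ^ (k + n) * ν v := by
    intro n
    induction n with
    | zero =>
      intro k v
      have h0 := hν v
      simp only [Function.iterate_zero, id_eq, add_zero]
      have h5 : ν (v - ρ v) ≤ max 1 (S * P) * ν v := by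
        refine hsub _ _ _ ?_ ?_
        · calc ν v = 1 * ν v := by ring
            _ ≤ _ := by gcongr; exact le_max_left _ _
        · calc _ ≤ S * (P * ν v) := (hρ v).trans (by gcongr; exact hκP _)
            _ = S * P * ν v := by ring
            _ ≤ _ := by gcongr; exact le_max_right _ _
      calc _ ≤ a * s ^ k * (max 1 (S * P) * ν v) := (hN k _ (hρN v)).trans (by gcongr)
        _ = a * max 1 (S * P) * s ^ k * ν v := by ring
        _ ≤ _ := by gcongr; exact le_max_left _ _
    | succ n ih =>
      intro k v
      have h0 := hν v
      -- This is `(1 - ρ) D = D (1 - ρ) + (D ρ - ρ D)`, whose last term lies in `N`.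
      have h6 : D^[k] (D^[n + 1] v - ρ (D^[n + 1] v)) =
          D^[k + 1] (D^[n] v - ρ (D^[n] v)) + D^[k] (D (ρ (D^[n] v)) - ρ (D (D^[n] v))) := by
        rw [Function.iterate_succ_apply D k, ← iterate_map_add D]
        congr 1
        rw [map_sub, Function.iterate_succ_apply' D n]
        abel
      rw [h6]
      refine hadd _ _ _ ((ih (k + 1) v).trans_eq ?_) ?_
      · rw [show k + 1 + n = k + (n + 1) by ring]
      · calc _ ≤ a * s ^ k * (Q * (b * s ^ n * ν v)) := by
              refine (hN k _ (hδN _)).trans ?_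
              gcongr
              exact (hδ _).trans (by gcongr; exact hκ n v)
          _ = a * Q * b / s * s ^ (k + (n + 1)) * ν v := by
              field_simp; ring
          _ ≤ _ := by gcongr; exact le_max_right _ _
  refine ⟨max C (S * b), le_max_of_le_left hC, fun n v => ?_⟩
  have h0 := hν v
  have h7 : D^[n] v = (D^[n] v - ρ (D^[n] v)) + ρ (D^[n] v) := by abel
  rw [h7]
  refine hadd _ _ _ ?_ ?_
  · calc _ ≤ C * s ^ n * ν v := by simpa using key n 0 v
      _ ≤ _ := by gcongr; exact le_max_left _ _
  · calc _ ≤ S * (b * s ^ n * ν v) := (hρ _).trans (by gcongr; exact hκ n v)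
      _ = S * b * s ^ n * ν v := by ring
      _ ≤ _ := by gcongr; exact le_max_right _ _

/-- Growth bounds for the first factor of a pairing compatible with the operators. -/
lemma pairing_growth {M U X : Type*} [AddCommGroup X] {νM : M → ℝ} {νU : U → ℝ} {νX : X → ℝ}
    (hsub : ∀ (x y : X) (c : ℝ), νX x ≤ c → νX y ≤ c → νX (x - y) ≤ c)
    (hM : ∀ m, 0 ≤ νM m) {fM : M → M} {fU : U → U} (fX : X →+ X) {B : M → U → X}
    (hB : ∀ m u, B (fM m) u = fX (B m u) - B m (fU u)) {s : ℝ} (hs : 0 ≤ s)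
    {b : ℝ} (hb : 0 ≤ b) (hBb : ∀ m u, νX (B m u) ≤ b * νM m * νU u)
    (hX : GrowthLE νX fX s) (hU : GrowthLE νU fU s) :
    ∃ C : ℝ, 0 ≤ C ∧ ∀ n m u, νX (B (fM^[n] m) u) ≤ C * s ^ n * (νM m * νU u) := by
  obtain ⟨CX, hCX, hX⟩ := hX
  obtain ⟨CU, hCU, hU⟩ := hU
  -- Each `fM` is traded for an `fX` or an `fU`. Carrying all three exponents avoids a binomial
  -- expansion, and the ultrametric bound keeps the constant fixed.
  have key : ∀ n k l m u, νX (fX^[k] (B (fM^[n] m) (fU^[l] u))) ≤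
      CX * b * CU * s ^ (k + n + l) * (νM m * νU u) := by
    intro n
    induction n with
    | zero =>
      intro k l m u
      have := hM m
      calc νX (fX^[k] (B m (fU^[l] u))) ≤ CX * s ^ k * νX (B m (fU^[l] u)) := hX _ _
        _ ≤ CX * s ^ k * (b * νM m * (CU * s ^ l * νU u)) := by
          gcongr
          refine (hBb _ _).trans ?_
          gcongr
          exact hU _ _
        _ = _ := by ring
    | succ n ih =>
      intro k l m u
      rw [Function.iterate_succ_apply', hB]
      have h1 : fX^[k] (fX (B (fM^[n] m) (fU^[l] u)) - B (fM^[n] m) (fU (fU^[l] u))) =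
          fX^[k + 1] (B (fM^[n] m) (fU^[l] u)) - fX^[k] (B (fM^[n] m) (fU^[l + 1] u)) := by
        rw [Function.iterate_succ_apply, Function.iterate_succ_apply', iterate_map_sub]
      rw [h1]
      refine hsub _ _ _ ((ih (k + 1) l m u).trans_eq ?_) ((ih k (l + 1) m u).trans_eq ?_)
      · rw [show k + 1 + n + l = k + (n + 1) + l by ring]
      · rw [show k + n + (l + 1) = k + (n + 1) + l by ring]
  refine ⟨CX * b * CU, by positivity, fun n m u => ?_⟩
  simpa using key n 0 0 m u

/-! ### Morphisms of differential modules; growth of submodules, quotients, extensions and duals. -/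

namespace DiffOp

section

variable {K : Type*} [Field K] {d : Derivation ℤ K K}
  {V : Type*} [AddCommGroup V] [Module K V] {W : Type*} [AddCommGroup W] [Module K W]

lemma map_smul' (D : DiffOp d V) (c : K) (v : V) : D (c • v) = d c • v + c • D v := D.leibniz' c v

/-- `f` commutes with the differential operators. -/
def Intertwines (D : DiffOp d V) (D' : DiffOp d W) (f : V →ₗ[K] W) : Prop :=
  ∀ v, f (D v) = D' (f v)

lemma Intertwines.iterate {D : DiffOp d V} {D' : DiffOp d W} {f : V →ₗ[K] W}
    (h : Intertwines D D' f) (n : ℕ) (v : V) : f (D^[n] v) = D'^[n] (f v) :=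
  (Function.Semiconj.iterate_right h n v)

lemma Intertwines.stable_ker {D : DiffOp d V} {D' : DiffOp d W} {f : V →ₗ[K] W}
    (h : Intertwines D D' f) : D.Stable (LinearMap.ker f) := fun v hv => by
  rw [LinearMap.mem_ker] at hv ⊢
  rw [h, hv]; exact D'.map_zero

lemma Intertwines.stable_map {D : DiffOp d V} {D' : DiffOp d W} {f : V →ₗ[K] W}
    (h : Intertwines D D' f) {N : Submodule K V} (hN : D.Stable N) : D'.Stable (N.map f) := by
  rintro _ ⟨v, hv, rfl⟩
  exact ⟨D v, hN v hv, h v⟩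

lemma Intertwines.stable_comap {D : DiffOp d V} {D' : DiffOp d W} {f : V →ₗ[K] W}
    (h : Intertwines D D' f) {N : Submodule K W} (hN : D'.Stable N) : D.Stable (N.comap f) := by
  intro v hv
  rw [Submodule.mem_comap] at hv ⊢
  rw [h]; exact hN _ hv

lemma Intertwines.stable_range {D : DiffOp d V} {D' : DiffOp d W} {f : V →ₗ[K] W}
    (h : Intertwines D D' f) : D'.Stable (LinearMap.range f) := by
  rintro _ ⟨v, rfl⟩
  exact ⟨D v, h v⟩

lemma intertwines_subtype (D : DiffOp d V) (N : Submodule K V) (hN : D.Stable N) :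
    Intertwines (D.restrict N hN) D N.subtype := fun _ => rfl

lemma intertwines_mkQ (D : DiffOp d V) (N : Submodule K V) (hN : D.Stable N) :
    Intertwines D (D.quotient N hN) N.mkQ := fun _ => rfl

lemma intertwines_codRestrict {D : DiffOp d V} {D' : DiffOp d W} {f : V →ₗ[K] W}
    (h : Intertwines D D' f) {N : Submodule K W} (hN : D'.Stable N) (hf : ∀ v, f v ∈ N) :
    Intertwines D (D'.restrict N hN) (f.codRestrict N hf) := fun v => Subtype.ext (h v)

lemma intertwines_liftQ {D : DiffOp d V} {D' : DiffOp d W} {f : V →ₗ[K] W}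
    (h : Intertwines D D' f) {N : Submodule K V} (hN : D.Stable N) (hf : N ≤ LinearMap.ker f) :
    Intertwines (D.quotient N hN) D' (N.liftQ f hf) := by
  intro v
  induction v using Submodule.Quotient.induction_on with | _ v
  exact h v

lemma Intertwines.comp {X : Type*} [AddCommGroup X] [Module K X]
    {D : DiffOp d V} {D' : DiffOp d W} {D'' : DiffOp d X} {f : V →ₗ[K] W} {g : W →ₗ[K] X}
    (hg : Intertwines D' D'' g) (hf : Intertwines D D' f) : Intertwines D D'' (g ∘ₗ f) :=
  fun v => by rw [LinearMap.comp_apply, hf, hg]; rfl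

lemma stable_bot (D : DiffOp d V) : D.Stable ⊥ := fun v hv => by
  rw [Submodule.mem_bot] at hv ⊢
  rw [hv]; exact D.map_zero

lemma stable_top (D : DiffOp d V) : D.Stable ⊤ := fun _ _ => Submodule.mem_top

lemma Stable.sup {D : DiffOp d V} {N N' : Submodule K V} (h : D.Stable N) (h' : D.Stable N') :
    D.Stable (N ⊔ N') := by
  intro v hv
  obtain ⟨a, ha, b, hb, rfl⟩ := Submodule.mem_sup.1 hv
  rw [show D (a + b) = D a + D b from D.map_add a b]
  exact Submodule.add_mem_sup (h a ha) (h' b hb)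

lemma Stable.inf {D : DiffOp d V} {N N' : Submodule K V} (h : D.Stable N) (h' : D.Stable N') :
    D.Stable (N ⊓ N') := fun v hv => ⟨h v hv.1, h' v hv.2⟩

/-- The operator on the dual space: `(D φ) v = d (φ v) - φ (D v)`. -/
def dual (D : DiffOp d V) : DiffOp d (Module.Dual K V) where
  toFun φ :=
    { toFun := fun v => d (φ v) - φ (D v)
      map_add' := fun v w => by
        rw [show D (v + w) = D v + D w from D.map_add v w]
        simp only [map_add]; ring
      map_smul' := fun c v => by
        rw [D.map_smul']
        simp only [map_smul, map_add, smul_eq_mul, Derivation.leibniz, RingHom.id_apply]; ring }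
  map_zero' := by ext v; simp
  map_add' φ ψ := by ext v; simp; ring
  leibniz' c φ := by
    ext v
    simp only [LinearMap.smul_apply, smul_eq_mul, Derivation.leibniz, LinearMap.coe_mk,
      AddHom.coe_mk, LinearMap.add_apply]; ring

lemma dual_apply (D : DiffOp d V) (φ : Module.Dual K V) (v : V) :
    D.dual φ v = d (φ v) - φ (D v) := rfl

end

section Growth

variable {K : Type*} [NontriviallyNormedField K] [IsUltrametricDist K] {d : Derivation ℤ K K}
  {V : Type*} [AddCommGroup V] [Module K V] [FiniteDimensional K V]
  {W : Type*} [AddCommGroup W] [Module K W] [FiniteDimensional K W]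
  {X : Type*} [AddCommGroup X] [Module K X] [FiniteDimensional K X] {s : ℝ}

/-- The iterates of `D` grow at most like `s ^ n`. -/
def Bdd (D : DiffOp d V) (s : ℝ) : Prop := GrowthLE (coordNorm K V) D s

lemma exists_coordNorm_le (hd : IsBoundedDerivation d) (D : DiffOp d V) :
    ∃ C : ℝ, 0 ≤ C ∧ ∀ v, coordNorm K V (D v) ≤ C * coordNorm K V v := by
  obtain ⟨C, hC⟩ := hd
  refine exists_coordNorm_le_of_basis D (fun t g => map_sum D.toAddMonoidHom g t) fun v =>
    ⟨max (C * coordNorm K V v) (coordNorm K V (D v)), fun c => ?_⟩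
  rw [D.map_smul']
  refine coordNorm_add_le ?_ ?_ <;> rw [coordNorm_smul]
  · have := hC c
    have h0 := coordNorm_nonneg (K := K) v
    calc ‖d c‖ * coordNorm K V v ≤ C * ‖c‖ * coordNorm K V v := by gcongr
      _ = C * coordNorm K V v * ‖c‖ := by ring
      _ ≤ _ := by gcongr; exact le_max_left _ _
  · rw [mul_comm]
    gcongr; exact le_max_right _ _

lemma Bdd.mono {D : DiffOp d V} {t : ℝ} (hs : 0 ≤ s) (hst : s ≤ t) (h : D.Bdd s) : D.Bdd t :=
  GrowthLE.mono coordNorm_nonneg hs hst h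

lemma Bdd.of_injective {D : DiffOp d V} {D' : DiffOp d W} {f : V →ₗ[K] W}
    (h : Intertwines D D' f) (hf : Function.Injective f) (hs : 0 ≤ s) (hD : D'.Bdd s) :
    D.Bdd s := by
  obtain ⟨C, hC, hD⟩ := hD
  obtain ⟨A, hA, hfA⟩ := exists_coordNorm_map_le f
  obtain ⟨B, hB, hfB⟩ := exists_coordNorm_le_of_injective f hf
  refine ⟨B * C * A, by positivity, fun n v => ?_⟩
  calc coordNorm K V (D^[n] v) ≤ B * coordNorm K W (f (D^[n] v)) := hfB _
    _ ≤ B * (C * s ^ n * (A * coordNorm K V v)) := by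
      rw [h.iterate]
      gcongr
      refine (hD n _).trans ?_
      gcongr
      exact hfA v
    _ = _ := by ring

lemma Bdd.of_surjective {D : DiffOp d V} {D' : DiffOp d W} {f : V →ₗ[K] W}
    (h : Intertwines D D' f) (hf : Function.Surjective f) (hs : 0 ≤ s) (hD : D.Bdd s) :
    D'.Bdd s := by
  obtain ⟨C, hC, hD⟩ := hD
  obtain ⟨A, hA, hfA⟩ := exists_coordNorm_map_le f
  obtain ⟨g, hg⟩ := f.exists_rightInverse_of_surjective (LinearMap.range_eq_top.2 hf)
  obtain ⟨B, hB, hgB⟩ := exists_coordNorm_map_le g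
  refine ⟨A * C * B, by positivity, fun n w => ?_⟩
  have hw : f (g w) = w := LinearMap.congr_fun hg w
  calc coordNorm K W (D'^[n] w) = coordNorm K W (f (D^[n] (g w))) := by rw [h.iterate, hw]
    _ ≤ A * (C * s ^ n * (B * coordNorm K W w)) := by
      refine (hfA _).trans ?_
      gcongr
      refine (hD n _).trans ?_
      gcongr
      exact hgB w
    _ = _ := by ring

lemma bdd_of_subsingleton [Subsingleton V] (D : DiffOp d V) : D.Bdd s :=
  ⟨0, le_rfl, fun n v => by rw [Subsingleton.elim (D^[n] v) 0]; simp⟩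

/-- Growth bounds are stable under extensions. -/
lemma Bdd.of_restrict_of_quotient (hd : IsBoundedDerivation d) (hs : 0 < s) {D : DiffOp d V}
    {N : Submodule K V} {hN : D.Stable N} (h1 : (D.restrict N hN).Bdd s)
    (h2 : (D.quotient N hN).Bdd s) : D.Bdd s := by
  obtain ⟨σ, hσ⟩ := N.mkQ.exists_rightInverse_of_surjective N.range_mkQ
  replace hσ : ∀ q, N.mkQ (σ q) = q := fun q => LinearMap.congr_fun hσ q
  obtain ⟨C1, hC1, h1⟩ := h1
  obtain ⟨C2, hC2, h2⟩ := h2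
  obtain ⟨A, hA, hDA⟩ := exists_coordNorm_le hd D
  obtain ⟨A', hA', hDA'⟩ := exists_coordNorm_le hd (D.quotient N hN)
  obtain ⟨P, hP, hPb⟩ := exists_coordNorm_map_le N.mkQ
  obtain ⟨S, hS, hSb⟩ := exists_coordNorm_map_le σ
  obtain ⟨I, hI, hIb⟩ := exists_coordNorm_map_le N.subtype
  obtain ⟨J, hJ, hJb⟩ := exists_coordNorm_le_of_injective N.subtype N.injective_subtype
  have hmem : ∀ v, v - σ (N.mkQ v) ∈ N := fun v => by
    have : N.mkQ (v - σ (N.mkQ v)) = 0 := by rw [map_sub, hσ, sub_self]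
    exact (Submodule.Quotient.mk_eq_zero N).1 this
  -- Here `ρ = σ ∘ N.mkQ` for a linear section `σ`, in general not a morphism of differential
  -- modules; its failure to commute with `D` takes values in `N` and is bounded.
  refine growthLE_of_splitting (κ := fun v => coordNorm K (V ⧸ N) (N.mkQ v))
    (a := I * C1 * J) (P := P) (b := C2 * P) (S := S) (Q := max (A * S) (S * A'))
    coordNorm_nonneg (fun x y c => coordNorm_add_le) (fun x y c => coordNorm_sub_le)
    D.toAddMonoidHom N (fun v => σ (N.mkQ v)) hs (by positivity) hS
    (le_max_of_le_left (by positivity)) ?_ hPb ?_ hmem (fun v => hSb _) ?_ ?_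
  · intro k w hw
    calc coordNorm K V (D^[k] w) = coordNorm K V (N.subtype ((D.restrict N hN)^[k] ⟨w, hw⟩)) := by
          rw [(intertwines_subtype D N hN).iterate]; rfl
      _ ≤ I * (C1 * s ^ k * (J * coordNorm K V w)) :=
          (hIb _).trans (mul_le_mul_of_nonneg_left ((h1 k ⟨w, hw⟩).trans
            (mul_le_mul_of_nonneg_left (hJb ⟨w, hw⟩) (by positivity))) hI)
      _ = _ := by ring
  · intro n v
    rw [(intertwines_mkQ D N hN).iterate]
    calc _ ≤ C2 * s ^ n * (P * coordNorm K V v) :=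
          (h2 n _).trans (mul_le_mul_of_nonneg_left (hPb v) (by positivity))
      _ = _ := by ring
  · intro v
    have h3 := hmem (D v)
    have h4 := hN _ (hmem v)
    rw [show D (v - σ (N.mkQ v)) = D v - D (σ (N.mkQ v)) from D.toAddMonoidHom.map_sub _ _] at h4
    have := N.sub_mem h3 h4
    rwa [sub_sub_sub_cancel_left] at this
  · intro v
    have h0 := coordNorm_nonneg (K := K) (N.mkQ v)
    refine coordNorm_sub_le (v := D (σ (N.mkQ v))) (w := σ (N.mkQ (D v))) ?_ ?_
    · calc _ ≤ A * (S * coordNorm K (V ⧸ N) (N.mkQ v)) := by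
            refine (hDA _).trans ?_
            gcongr; exact hSb _
        _ = A * S * coordNorm K (V ⧸ N) (N.mkQ v) := by ring
        _ ≤ _ := by gcongr; exact le_max_left _ _
    · have h5 : coordNorm K (V ⧸ N) (N.mkQ (D v)) ≤ A' * coordNorm K (V ⧸ N) (N.mkQ v) := by
        rw [intertwines_mkQ D N hN v]
        exact hDA' (N.mkQ v)
      calc _ ≤ S * (A' * coordNorm K (V ⧸ N) (N.mkQ v)) :=
            (hSb (N.mkQ (D v))).trans (mul_le_mul_of_nonneg_left h5 hS)
        _ = S * A' * coordNorm K (V ⧸ N) (N.mkQ v) := by ring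
        _ ≤ _ := by gcongr; exact le_max_right _ _

/-- Growth bounds for the ends of an exact sequence give one for the middle term. -/
lemma Bdd.of_exact (hd : IsBoundedDerivation d) (hs : 0 < s) {D : DiffOp d V}
    {D' : DiffOp d W} {D'' : DiffOp d X} {f : V →ₗ[K] W} {g : W →ₗ[K] X}
    (hf : Intertwines D D' f) (hg : Intertwines D' D'' g)
    (hfg : LinearMap.ker g = LinearMap.range f)
    (h1 : D.Bdd s) (h2 : D''.Bdd s) : D'.Bdd s := by
  have hk := hg.stable_ker
  have hfk : ∀ v, f v ∈ LinearMap.ker g := fun v => by rw [hfg]; exact ⟨v, rfl⟩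
  refine Bdd.of_restrict_of_quotient hd hs (hN := hk) ?_ ?_
  · refine Bdd.of_surjective (intertwines_codRestrict hf hk hfk) ?_ hs.le h1
    rintro ⟨w, hw⟩
    rw [hfg] at hw
    obtain ⟨v, rfl⟩ := hw
    exact ⟨v, rfl⟩
  · exact Bdd.of_injective (intertwines_liftQ hg hk le_rfl)
      (LinearMap.ker_eq_bot.1 (Submodule.ker_liftQ_eq_bot _ _ _ le_rfl)) hs.le h2

/-- The growth of an operator on a nonzero space dominates that of the derivation. -/
lemma Bdd.growthLE_derivation [Nontrivial V] {D : DiffOp d V} (hs : 0 ≤ s) (h : D.Bdd s) :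
    GrowthLE (fun x : K => ‖x‖) d s := by
  obtain ⟨v, hv⟩ := exists_ne (0 : V)
  have hv' : 0 < coordNorm K V v :=
    (coordNorm_nonneg _).lt_of_ne fun h => hv (coordNorm_eq_zero.1 h.symm)
  -- Scalar multiplication is a pairing with `d c • u = D (c • u) - c • D u`; evaluating at one `v ≠
  -- 0` isolates the growth of `d`.
  obtain ⟨C, hC, h'⟩ := pairing_growth (νM := fun x : K => ‖x‖) (νU := coordNorm K V)
    (νX := coordNorm K V) (fM := d) (fU := D) (B := fun c v => c • v)
    (fun x y c => coordNorm_sub_le) (fun _ => norm_nonneg _) D.toAddMonoidHom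
    (fun c u => by
      rw [show D.toAddMonoidHom (c • u) = d c • u + c • D u from D.map_smul' c u]; abel)
    hs zero_le_one (fun c u => by rw [coordNorm_smul, one_mul]) h h
  refine ⟨C, hC, fun n c => ?_⟩
  have := h' n c v
  rw [coordNorm_smul, ← mul_assoc] at this
  exact le_of_mul_le_mul_right this hv'

/-- The evaluation pairing satisfies the Leibniz rule, so `pairing_growth` controls the values of
the iterates of `φ` on a basis; the dual basis turns these into a bound on the norm. -/
lemma Bdd.dual {D : DiffOp d V} (hs : 0 ≤ s) (hds : GrowthLE (fun x : K => ‖x‖) d s)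
    (h : D.Bdd s) : D.dual.Bdd s := by
  let b := Module.finBasis K V
  have heval : ∃ C : ℝ, 0 ≤ C ∧ ∀ (φ : Module.Dual K V) (v : V),
      ‖φ v‖ ≤ C * coordNorm K (Module.Dual K V) φ * coordNorm K V v := by
    choose C hC h using fun i => exists_norm_map_le (Module.Dual.eval K V (b i))
    refine ⟨∑ i, C i, Finset.sum_nonneg fun i _ => hC i, fun φ v => ?_⟩
    have h0 := coordNorm_nonneg (K := K) v
    have h1 := coordNorm_nonneg (K := K) φ
    have hSC : 0 ≤ ∑ i, C i := Finset.sum_nonneg fun i _ => hC i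
    conv_lhs => rw [← b.sum_equivFun v, map_sum]
    refine IsUltrametricDist.norm_sum_le_of_forall_le_of_nonneg (by positivity) fun i _ => ?_
    rw [map_smul, norm_smul, mul_comm]
    gcongr
    · refine (h i φ).trans ?_
      gcongr
      exact Finset.single_le_sum (f := C) (fun i _ => hC i) (Finset.mem_univ i)
    · exact norm_finBasis_coord_le v i
  obtain ⟨A, hA, heval⟩ := heval
  obtain ⟨C, hC, h'⟩ := pairing_growth (νM := coordNorm K (Module.Dual K V)) (νU := coordNorm K V)
    (νX := fun x : K => ‖x‖) (fM := D.dual) (fU := D) (B := fun φ v => φ v)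
    (fun x y c hx hy => by
      simpa [sub_eq_add_neg] using
        (IsUltrametricDist.norm_add_le_max x (-y)).trans (max_le hx (by simpa using hy))) coordNorm_nonneg
    (d : K →+ K) (fun φ v => D.dual_apply φ v) hs hA heval hds h
  refine ⟨∑ i, coordNorm K (Module.Dual K V) (b.coord i) * (C * coordNorm K V (b i)),
    Finset.sum_nonneg fun i _ => mul_nonneg (coordNorm_nonneg _)
      (mul_nonneg hC (coordNorm_nonneg _)), fun n φ => ?_⟩
  have hterm : ∀ i, 0 ≤ coordNorm K (Module.Dual K V) (b.coord i) * (C * coordNorm K V (b i)) :=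
    fun i => mul_nonneg (coordNorm_nonneg _) (mul_nonneg hC (coordNorm_nonneg _))
  have h0 := coordNorm_nonneg (K := K) φ
  conv_lhs => rw [← b.sum_dual_apply_smul_coord (D.dual^[n] φ)]
  refine coordNorm_sum_le _ _ (mul_nonneg (mul_nonneg (Finset.sum_nonneg fun i _ => hterm i)
    (by positivity)) h0) fun i _ => ?_
  rw [coordNorm_smul]
  calc _ ≤ C * s ^ n * (coordNorm K (Module.Dual K V) φ * coordNorm K V (b i)) *
        coordNorm K (Module.Dual K V) (b.coord i) :=
        mul_le_mul_of_nonneg_right (h' n φ (b i)) (coordNorm_nonneg _)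
    _ = coordNorm K (Module.Dual K V) (b.coord i) * (C * coordNorm K V (b i)) * s ^ n *
        coordNorm K (Module.Dual K V) φ := by ring
    _ ≤ _ := by
        gcongr
        exact Finset.single_le_sum
          (f := fun i => coordNorm K (Module.Dual K V) (b.coord i) * (C * coordNorm K V (b i)))
          (fun i _ => hterm i) (Finset.mem_univ i)

end Growth

end DiffOp

/-! ### Two uses of completeness: equivalence of norms and fixed points. -/

section Complete

variable {K : Type*} [NontriviallyNormedField K] [IsUltrametricDist K] [CompleteSpace K]
  {Q : Type*} [AddCommGroup Q] [Module K Q] [FiniteDimensional K Q]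

/-- Over a complete field the coordinate norm is dominated by every norm. -/
lemma exists_coordNorm_le_of_seminorm (q : Seminorm K Q) (hq : ∀ x, q x = 0 → x = 0) :
    ∃ C : ℝ, 0 ≤ C ∧ ∀ x, coordNorm K Q x ≤ C * q x := by
  let _ : Norm Q := ⟨q⟩
  let core : NormedSpace.Core K Q :=
    { norm_nonneg := fun x => apply_nonneg q x
      norm_smul := fun c x => map_smul_eq_mul q c x
      norm_triangle := fun x y => map_add_le_add q x y
      norm_eq_zero_iff := fun x => ⟨hq x, fun h => by rw [h]; exact map_zero q⟩ }
  let _ : NormedAddCommGroup Q := NormedAddCommGroup.ofCore core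
  let _ : NormedSpace K Q := NormedSpace.ofCore core
  -- Completeness of `K` enters here: every linear map from a finite-dimensional normed space is
  -- continuous.
  let f : Q →L[K] (Fin (Module.finrank K Q) → K) :=
    LinearMap.toContinuousLinearMap ((Module.finBasis K Q).equivFun : Q →ₗ[K] _)
  exact ⟨‖f‖, norm_nonneg _, fun x => f.le_opNorm x⟩

/-- An additive map halving the norm differs from the identity by a surjection. -/
lemma exists_sub_eq_of_contracting (E : Q → Q) (hsub : ∀ x y, E (x - y) = E x - E y)
    (hE : ∀ x, coordNorm K Q (E x) ≤ (1 / 2) * coordNorm K Q x) (y : Q) :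
    ∃ z, z - E z = y := by
  let φ := (Module.finBasis K Q).equivFun
  let T : (Fin (Module.finrank K Q) → K) → (Fin (Module.finrank K Q) → K) :=
    fun x => φ y + φ (E (φ.symm x))
  have hT : ContractingWith (1 / 2) T := by
    refine ⟨by rw [← NNReal.coe_lt_coe]; norm_num, LipschitzWith.of_dist_le_mul fun x x' => ?_⟩
    have := hE (φ.symm x - φ.symm x')
    rw [hsub] at this
    have h1 : coordNorm K Q (φ.symm x - φ.symm x') = ‖x - x'‖ := by
      rw [← map_sub, coordNorm]; exact congrArg _ (φ.apply_symm_apply _)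
    rw [h1] at this
    rw [dist_eq_norm, dist_eq_norm]
    have h2 : T x - T x' = φ (E (φ.symm x) - E (φ.symm x')) := by
      simp only [T, map_sub]; abel
    rw [h2]
    exact this.trans_eq (by norm_num)
  refine ⟨φ.symm (hT.fixedPoint T), ?_⟩
  apply φ.injective
  have h : T (hT.fixedPoint T) = hT.fixedPoint T := hT.fixedPoint_isFixedPt
  rw [map_sub, LinearEquiv.apply_symm_apply, sub_eq_iff_eq_add]
  exact h.symm

end Complete

/-! ### Balls given by weighted combinations, and their gauge. -/

section WeightedBall

variable {K : Type*} [NontriviallyNormedField K] [IsUltrametricDist K] {α : Type*}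
  {Q : Type*} [AddCommGroup Q] [Module K Q]

/-- The combinations of a family of vectors in which the coefficients, multiplied by the
weights `w`, have absolute value at most `t`. -/
def weightedBall (x : α → Q) (w : α → ℝ) (t : ℝ) : Set Q :=
  {v | ∃ b : α →₀ K, Finsupp.linearCombination K x b = v ∧ ∀ p, ‖b p‖ * w p ≤ t}

variable {x : α → Q} {w : α → ℝ}

lemma weightedBall_zero_mem {t : ℝ} (ht : 0 ≤ t) : (0 : Q) ∈ weightedBall (K := K) x w t :=
  ⟨0, by simp, fun p => by simpa using ht⟩

lemma weightedBall_add_mem (hw : ∀ p, 0 ≤ w p) {t : ℝ} {u v : Q}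
    (hu : u ∈ weightedBall (K := K) x w t)
    (hv : v ∈ weightedBall (K := K) x w t) : u + v ∈ weightedBall (K := K) x w t := by
  obtain ⟨b, rfl, hb⟩ := hu
  obtain ⟨c, rfl, hc⟩ := hv
  refine ⟨b + c, map_add _ _ _, fun p => ?_⟩
  have := hw p
  calc ‖(b + c) p‖ * w p ≤ max ‖b p‖ ‖c p‖ * w p := by
        gcongr; exact IsUltrametricDist.norm_add_le_max _ _
    _ = max (‖b p‖ * w p) (‖c p‖ * w p) := max_mul_of_nonneg _ _ (hw p)
    _ ≤ t := max_le (hb p) (hc p)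

lemma weightedBall_smul_mem {t : ℝ} (c : K) {u : Q} (hu : u ∈ weightedBall (K := K) x w t) :
    c • u ∈ weightedBall (K := K) x w (‖c‖ * t) := by
  obtain ⟨b, rfl, hb⟩ := hu
  refine ⟨c • b, map_smul _ _ _, fun p => ?_⟩
  rw [Finsupp.smul_apply, norm_smul, mul_assoc]
  gcongr
  exact hb p

lemma weightedBall_mono {t t' : ℝ} (h : t ≤ t') :
    weightedBall (K := K) x w t ⊆ weightedBall (K := K) x w t' :=
  fun _ ⟨b, hb, hb'⟩ => ⟨b, hb, fun p => (hb' p).trans h⟩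

lemma weightedBall_smul_self_mem {t : ℝ} (ht : 0 ≤ t) {c : K} {p : α} (h : ‖c‖ * w p ≤ t) :
    c • x p ∈ weightedBall (K := K) x w t := by
  classical
  refine ⟨Finsupp.single p c, by simp, fun p' => ?_⟩
  by_cases hp : p = p'
  · subst hp; simpa using h
  · simpa [Finsupp.single_apply, hp] using ht

lemma weightedBall_sum_mem (hw : ∀ p, 0 ≤ w p) {t : ℝ} (ht : 0 ≤ t) {ι : Type*} (s : Finset ι)
    {f : ι → Q} (hf : ∀ i ∈ s, f i ∈ weightedBall (K := K) x w t) :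
    ∑ i ∈ s, f i ∈ weightedBall (K := K) x w t := by
  classical
  induction s using Finset.induction_on with
  | empty => simpa using weightedBall_zero_mem ht
  | insert a s ha ih =>
    rw [Finset.sum_insert ha]
    exact weightedBall_add_mem hw (hf a (by simp)) (ih fun i hi => hf i (by simp [hi]))

/-- In a finite-dimensional space over a complete field, a weighted ball whose scalings intersect
in zero is bounded. -/
lemma exists_coordNorm_le_of_weightedBall [CompleteSpace K] [FiniteDimensional K Q]
    (hw : ∀ p, 0 ≤ w p) (hspan : Submodule.span K (Set.range x) = ⊤)
    (hsep : ∀ v, (∀ ε > 0, v ∈ weightedBall (K := K) x w ε) → v = 0) :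
    ∃ C : ℝ, 0 ≤ C ∧ ∀ t v, 0 ≤ t → v ∈ weightedBall (K := K) x w t →
      coordNorm K Q v ≤ C * t := by
  let S : Q → Set ℝ := fun v => {t | 0 ≤ t ∧ v ∈ weightedBall (K := K) x w t}
  have hbdd : ∀ v, BddBelow (S v) := fun v => ⟨0, fun t ht => ht.1⟩
  have hne : ∀ v, (S v).Nonempty := by
    intro v
    have hv : v ∈ Submodule.span K (Set.range x) := hspan ▸ Submodule.mem_top
    obtain ⟨b, rfl⟩ := (Finsupp.mem_span_range_iff_exists_finsupp).1 hv
    refine ⟨∑ p ∈ b.support, ‖b p‖ * w p,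
      Finset.sum_nonneg fun p _ => mul_nonneg (norm_nonneg _) (hw p), b, rfl, fun p => ?_⟩
    by_cases hp : p ∈ b.support
    · exact Finset.single_le_sum (f := fun p => ‖b p‖ * w p)
        (fun p _ => mul_nonneg (norm_nonneg _) (hw p)) hp
    · rw [Finsupp.notMem_support_iff.1 hp, norm_zero, zero_mul]
      exact Finset.sum_nonneg fun p _ => mul_nonneg (norm_nonneg _) (hw p)
  have hnonneg : ∀ v, 0 ≤ sInf (S v) := fun v => Real.sInf_nonneg fun t ht => ht.1
  have hle : ∀ {v t}, 0 ≤ t → v ∈ weightedBall (K := K) x w t → sInf (S v) ≤ t :=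
    fun ht hv => csInf_le (hbdd _) ⟨ht, hv⟩
  have hlt : ∀ {v t}, sInf (S v) < t → v ∈ weightedBall (K := K) x w t := by
    intro v t h
    obtain ⟨t', ht', h'⟩ := exists_lt_of_csInf_lt (hne v) h
    exact weightedBall_mono h'.le ht'.2
  -- The gauge of the balls. The infimum need not be attained, hence the slack `ε`.
  let q : Seminorm K Q := Seminorm.ofSMulLE (fun v => sInf (S v))
    (le_antisymm (hle le_rfl (weightedBall_zero_mem le_rfl)) (hnonneg 0))
    (fun u v => by
      refine le_of_forall_pos_le_add fun ε hε => ?_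
      have h1 := hnonneg u
      have h2 := hnonneg v
      refine hle (by positivity) (weightedBall_add_mem hw (hlt ?_) (hlt ?_)) <;> linarith)
    (fun c u => by
      have h1 := hnonneg u
      refine le_of_forall_pos_le_add fun ε hε => ?_
      have h2 : sInf (S u) < sInf (S u) + ε / (‖c‖ + 1) := by
        have : 0 < ε / (‖c‖ + 1) := by positivity
        linarith
      refine (hle (by positivity) (weightedBall_smul_mem c (hlt h2))).trans ?_
      have h3 : ‖c‖ * (ε / (‖c‖ + 1)) ≤ ε := by
        rw [mul_div_assoc', div_le_iff₀ (by positivity)]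
        nlinarith [norm_nonneg c]
      rw [mul_add]
      linarith)
  obtain ⟨C, hC, h⟩ := exists_coordNorm_le_of_seminorm q fun v hv =>
    hsep v fun ε hε => hlt (by change sInf (S v) = 0 at hv; rw [hv]; exact hε)
  exact ⟨C, hC, fun t v ht hv => (h v).trans (mul_le_mul_of_nonneg_left (hle ht hv) hC)⟩

end WeightedBall

/-! ### Modules without slow quotients and the surjectivity criterion. -/

namespace DiffOp

variable {K : Type*} [NontriviallyNormedField K] [IsUltrametricDist K] {d : Derivation ℤ K K}
  {V : Type*} [AddCommGroup V] [Module K V] [FiniteDimensional K V]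
  {W : Type*} [AddCommGroup W] [Module K W] [FiniteDimensional K W] {s : ℝ}

/-- No nonzero differential submodule of `(V, D)` has growth at most `s`. -/
def NoSub (D : DiffOp d V) (s : ℝ) : Prop :=
  ∀ (N : Submodule K V) (hN : D.Stable N), (D.restrict N hN).Bdd s → N = ⊥

/-- No nonzero quotient of `(V, D)` has growth at most `s`. -/
def NoQuot (D : DiffOp d V) (s : ℝ) : Prop :=
  ∀ (N : Submodule K V) (hN : D.Stable N), (D.quotient N hN).Bdd s → N = ⊤

/-- The quotient by the kernel embeds in the slow target, so it is slow and hence zero. -/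
lemma NoQuot.eq_zero {D : DiffOp d V} {D' : DiffOp d W} {f : V →ₗ[K] W} (h : D.NoQuot s)
    (hs : 0 ≤ s) (hf : Intertwines D D' f) (hD' : D'.Bdd s) : f = 0 := by
  have := h _ hf.stable_ker (Bdd.of_injective (intertwines_liftQ hf hf.stable_ker le_rfl)
    (LinearMap.ker_eq_bot.1 (Submodule.ker_liftQ_eq_bot _ _ _ le_rfl)) hs hD')
  exact LinearMap.ker_eq_top.1 this

lemma NoSub.eq_zero {D : DiffOp d V} {D' : DiffOp d W} {f : V →ₗ[K] W} (h : D'.NoSub s)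
    (hs : 0 ≤ s) (hf : Intertwines D D' f) (hD : D.Bdd s) : f = 0 := by
  have := h _ hf.stable_range (Bdd.of_surjective
    (intertwines_codRestrict hf hf.stable_range fun v => ⟨v, rfl⟩)
    (by rintro ⟨_, v, rfl⟩; exact ⟨v, rfl⟩) hs hD)
  exact LinearMap.range_eq_bot.1 this

/-- Growth bounds can be checked on generators. -/
lemma bdd_of_generators {ι : Type*} [Fintype ι] (D : DiffOp d V) (hs : 0 ≤ s)
    (hds : GrowthLE (fun x : K => ‖x‖) d s) (e : ι → V) (l : ι → V →ₗ[K] K)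
    (hl : ∀ v, v = ∑ i, l i v • e i) {C : ℝ} (hC : 0 ≤ C)
    (h : ∀ n i, coordNorm K V (D^[n] (e i)) ≤ C * s ^ n) : D.Bdd s := by
  obtain ⟨A, hA, hds⟩ := hds
  -- By the Leibniz rule each `D` falls either on the coefficient or on the generator; the
  -- ultrametric inequality makes the number of terms irrelevant.
  have key : ∀ i n k m c, coordNorm K V (D^[n] (d^[k] c • D^[m] (e i))) ≤
      A * C * s ^ (n + k + m) * ‖c‖ := by
    intro i n
    induction n with
    | zero =>
      intro k m c
      simp only [Function.iterate_zero, id_eq, coordNorm_smul]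
      calc _ ≤ A * s ^ k * ‖c‖ * (C * s ^ m) :=
            mul_le_mul (hds k c) (h m i) (coordNorm_nonneg _) (by positivity)
        _ = _ := by ring
    | succ n ih =>
      intro k m c
      rw [Function.iterate_succ_apply, D.map_smul', iterate_map_add D.toAddMonoidHom,
        ← Function.iterate_succ_apply' D, ← Function.iterate_succ_apply' d]
      refine coordNorm_add_le ((ih (k + 1) m c).trans_eq ?_) ((ih k (m + 1) c).trans_eq ?_)
      · rw [show n + (k + 1) + m = n + 1 + k + m by ring]
      · rw [show n + k + (m + 1) = n + 1 + k + m by ring]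
  choose P hP hlP using fun i => exists_norm_map_le (l i)
  refine ⟨A * C * ∑ i, P i, mul_nonneg (by positivity) (Finset.sum_nonneg fun i _ => hP i),
    fun n v => ?_⟩
  have h0 := coordNorm_nonneg (K := K) v
  have hSP : 0 ≤ ∑ i, P i := Finset.sum_nonneg fun i _ => hP i
  have hsum : D^[n] v = ∑ i, D^[n] (l i v • e i) := by
    conv_lhs => rw [hl v]
    exact map_sum (⟨⟨D^[n], iterate_map_zero D.toAddMonoidHom n⟩,
      iterate_map_add D.toAddMonoidHom n⟩ : V →+ V) _ _
  rw [hsum]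
  refine coordNorm_sum_le _ _ (by positivity) fun i _ => ?_
  calc _ ≤ A * C * s ^ n * ‖l i v‖ := by simpa using key i n 0 0 (l i v)
    _ ≤ A * C * s ^ n * ((∑ i, P i) * coordNorm K V v) := by
        gcongr
        refine (hlP i v).trans ?_
        gcongr
        exact Finset.single_le_sum (f := P) (fun i _ => hP i) (Finset.mem_univ i)
    _ = _ := by ring

variable [CompleteSpace K]

/-- If `(V, D)` has no quotient of growth at most `s`, then every vector is a combination of the
`D ^ i (e j)`, for a basis `e`, with coefficients small compared to `s ^ (-i)`. -/
lemma NoQuot.mem_weightedBall (hd : IsBoundedDerivation d) {D : DiffOp d V} (hs : 0 < s)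
    (hds : GrowthLE (fun x : K => ‖x‖) d s) (h : D.NoQuot s) {ι : Type*} [Fintype ι]
    (e : Module.Basis ι K V) (v : V) {ε : ℝ} (hε : 0 < ε) :
    v ∈ weightedBall (K := K) (fun p : ℕ × ι => D^[p.1] (e p.2)) (fun p => s ^ p.1) ε := by
  set x : ℕ × ι → V := fun p => D^[p.1] (e p.2) with hx
  set w : ℕ × ι → ℝ := fun p => s ^ p.1 with hw
  have hw0 : ∀ p, 0 ≤ w p := fun p => by positivity
  -- The intersection of the balls of all positive radii; the claim becomes `N = ⊤`.
  let N : Submodule K V :=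
    { carrier := {v | ∀ ε > 0, v ∈ weightedBall (K := K) x w ε}
      add_mem' := fun hu hv ε hε => weightedBall_add_mem hw0 (hu ε hε) (hv ε hε)
      zero_mem' := fun ε hε => weightedBall_zero_mem hε.le
      smul_mem' := fun c u hu ε hε => by
        refine weightedBall_mono ?_ (weightedBall_smul_mem c (hu (ε / (‖c‖ + 1)) (by positivity)))
        rw [mul_div_assoc', div_le_iff₀ (by positivity)]
        nlinarith [norm_nonneg c] }
  have hN : D.Stable N := by
    intro u hu ε hε
    obtain ⟨A, hA⟩ := hd
    -- Differentiating a coefficient costs at most `|A|`, and shifting `D ^ i` to `D ^ (i + 1)`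
    -- costs `s`.
    obtain ⟨b, rfl, hb⟩ := hu (ε / (max |A| s)) (by positivity)
    have hb' : ∀ p, ‖b p‖ * w p * max |A| s ≤ ε := fun p => (le_div_iff₀ (by positivity)).1 (hb p)
    rw [Finsupp.linearCombination_apply, Finsupp.sum,
      show D (∑ p ∈ b.support, b p • x p) = ∑ p ∈ b.support, D (b p • x p) from
        map_sum D.toAddMonoidHom _ _]
    refine weightedBall_sum_mem hw0 hε.le _ fun p _ => ?_
    rw [D.map_smul']
    refine weightedBall_add_mem hw0 (weightedBall_smul_self_mem hε.le ?_) ?_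
    · refine le_trans ?_ (hb' p)
      have := hw0 p
      calc ‖d (b p)‖ * w p ≤ |A| * ‖b p‖ * w p := by
            gcongr
            exact (hA _).trans (by gcongr; exact le_abs_self A)
        _ = ‖b p‖ * w p * |A| := by ring
        _ ≤ _ := by gcongr; exact le_max_left _ _
    · have h1 : D (x p) = x (p.1 + 1, p.2) := (Function.iterate_succ_apply' D p.1 _).symm
      rw [h1]
      refine weightedBall_smul_self_mem hε.le ((le_trans ?_ (hb' p)))
      have := hw0 p
      calc ‖b p‖ * s ^ (p.1 + 1) = ‖b p‖ * w p * s := by rw [hw]; ring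
        _ ≤ _ := by gcongr; exact le_max_right _ _
  -- In `V / N` the balls intersect in zero, so they are bounded in the coordinate norm. The class
  -- of `D ^ n e_i` lies in the ball of radius `s ^ n`, so `V / N` is slow.
  have htop : N = ⊤ := by
    refine h N hN ?_
    have hspan : Submodule.span K (Set.range fun p => N.mkQ (x p)) = ⊤ := by
      rw [show (fun p => N.mkQ (x p)) = N.mkQ ∘ x from rfl, Set.range_comp, Submodule.span_image]
      have : Submodule.span K (Set.range x) = ⊤ := by
        rw [eq_top_iff, ← e.span_eq]
        refine Submodule.span_mono ?_
        rintro _ ⟨i, rfl⟩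
        exact ⟨(0, i), rfl⟩
      rw [this, Submodule.map_top, Submodule.range_mkQ]
    obtain ⟨C, hC, hCb⟩ := exists_coordNorm_le_of_weightedBall (K := K) hw0 hspan (by
      intro y hy
      obtain ⟨v, rfl⟩ := N.mkQ_surjective y
      refine (Submodule.Quotient.mk_eq_zero N).2 fun ε hε => ?_
      obtain ⟨b, hb, hb'⟩ := hy ε hε
      have h1 : N.mkQ (Finsupp.linearCombination K x b) = N.mkQ v := by
        rw [← hb, Finsupp.apply_linearCombination]; rfl
      have h2 : v - Finsupp.linearCombination K x b ∈ N := by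
        rw [← Submodule.Quotient.mk_eq_zero]
        exact (map_sub N.mkQ _ _).trans (sub_eq_zero.2 h1.symm)
      have := weightedBall_add_mem hw0 (h2 ε hε) ⟨b, rfl, hb'⟩
      rwa [sub_add_cancel] at this)
    obtain ⟨σ, hσ⟩ := N.mkQ.exists_rightInverse_of_surjective N.range_mkQ
    refine bdd_of_generators _ hs.le hds (fun i => N.mkQ (e i)) (fun i => e.coord i ∘ₗ σ) ?_ hC ?_
    · intro y
      conv_lhs => rw [← LinearMap.id_apply (R := K) y, ← hσ, LinearMap.comp_apply,
        ← e.sum_repr (σ y), map_sum]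
      simp
    · intro n i
      rw [← (intertwines_mkQ D N hN).iterate]
      refine hCb _ _ (by positivity) ?_
      have := weightedBall_smul_self_mem (K := K) (x := fun p => N.mkQ (x p)) (w := w)
        (t := s ^ n) (by positivity) (c := 1) (p := (n, i)) (by simp [hw])
      rwa [one_smul] at this
  have : v ∈ N := htop ▸ Submodule.mem_top
  exact this ε hε

/-- Surjectivity criterion: if `M` has no quotient of growth at most `s` and `U` has growth at
most `s`, then a balanced pairing `B` of `M` and `U` takes its values in every subgroup modulo
which the operators on `M` and `U` are adjoint. -/
theorem NoQuot.pairing_mem (hd : IsBoundedDerivation d) {D : DiffOp d V} (hs : 0 < s)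
    (hds : GrowthLE (fun x : K => ‖x‖) d s) (h : D.NoQuot s) {X : Type*} [AddCommGroup X]
    (B : V →+ W →+ X) (hB : ∀ (c : K) v u, B (c • v) u = B v (c • u)) (F : W →+ W)
    (hF : GrowthLE (coordNorm K W) F s) (I : AddSubgroup X)
    (hI : ∀ v u, B (D v) u - B v (F u) ∈ I) (v : V) (u : W) : B v u ∈ I := by
  classical
  have hIn : ∀ n v u, B (D^[n] v) u - B v (F^[n] u) ∈ I := by
    intro n
    induction n with
    | zero => intro v u; simp [I.zero_mem]
    | succ n ih =>
      intro v u
      have := I.add_mem (ih (D v) u) (hI v (F^[n] u))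
      rwa [sub_add_sub_cancel, ← Function.iterate_succ_apply D,
        ← Function.iterate_succ_apply' F] at this
  obtain ⟨C, hC, hF⟩ := hF
  set ι := Fin (Module.finrank K V)
  set e := Module.finBasis K V
  choose S hS hSb using fun i : ι => exists_coordNorm_map_le (LinearMap.single K (fun _ : ι => W) i)
  choose P hP hPb using fun i : ι => exists_coordNorm_map_le
    (LinearMap.proj i : (ι → W) →ₗ[K] W)
  have hSP : 0 ≤ (∑ i, S i) * C * ∑ i, P i :=
    mul_nonneg (mul_nonneg (Finset.sum_nonneg fun i _ => hS i) hC)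
      (Finset.sum_nonneg fun i _ => hP i)
  -- Chosen to make `E` below contract by `1 / 2`.
  set ε := 1 / (2 * ((∑ i, S i) * C * (∑ i, P i) + 1)) with hε
  have hε0 : 0 < ε := by positivity
  choose b hb hbε using fun i : ι => h.mem_weightedBall hd hs hds e (e i) hε0
  -- Replace each `e l` in `∑ B (e l) (y l)` by its expansion in the `D ^ i e_j` and move the
  -- coefficients and the powers of `D` to the other side: modulo `I` this turns `y` into `E y`.
  let E : (ι → W) → (ι → W) := fun y =>
    ∑ l, ∑ p ∈ (b l).support, Pi.single p.2 (F^[p.1] (b l p • y l))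
  have hEsub : ∀ y z, E (y - z) = E y - E z := by
    intro y z
    simp only [E, ← Finset.sum_sub_distrib, ← Pi.single_sub, Pi.sub_apply, smul_sub,
      iterate_map_sub]
  have hEb : ∀ y, coordNorm K (ι → W) (E y) ≤ (1 / 2) * coordNorm K (ι → W) y := by
    intro y
    have h0 := coordNorm_nonneg (K := K) y
    refine coordNorm_sum_le _ _ (by positivity) fun l _ =>
      coordNorm_sum_le _ _ (by positivity) fun p _ => ?_
    have h1 : coordNorm K W (y l) ≤ (∑ i, P i) * coordNorm K (ι → W) y :=
      (hPb l y).trans (mul_le_mul_of_nonneg_right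
        (Finset.single_le_sum (f := P) (fun i _ => hP i) (Finset.mem_univ l)) h0)
    have h2 : coordNorm K W (F^[p.1] (b l p • y l)) ≤ C * ε * coordNorm K W (y l) := by
      have h3 := coordNorm_nonneg (K := K) (y l)
      calc _ ≤ C * s ^ p.1 * (‖b l p‖ * coordNorm K W (y l)) := by
            rw [← coordNorm_smul]; exact hF _ _
        _ = C * (‖b l p‖ * s ^ p.1) * coordNorm K W (y l) := by ring
        _ ≤ _ := by gcongr; exact hbε l p
    have h4 : 0 ≤ ∑ i, S i := Finset.sum_nonneg fun i _ => hS i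
    calc _ ≤ S p.2 * coordNorm K W (F^[p.1] (b l p • y l)) := hSb p.2 _
      _ ≤ (∑ i, S i) * (C * ε * ((∑ i, P i) * coordNorm K (ι → W) y)) := by
          refine mul_le_mul (Finset.single_le_sum (f := S) (fun i _ => hS i) (Finset.mem_univ p.2))
            (h2.trans ?_) (coordNorm_nonneg _) h4
          gcongr
      _ = ((∑ i, S i) * C * (∑ i, P i) * ε) * coordNorm K (ι → W) y := by ring
      _ ≤ (1 / 2) * coordNorm K (ι → W) y := by
          gcongr
          rw [hε, mul_one_div, div_le_div_iff₀ (by positivity) (by norm_num)]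
          linarith
  let β : (ι → W) →+ X :=
    { toFun := fun y => ∑ j, B (e j) (y j)
      map_zero' := by simp
      map_add' := fun y z => by simp [Finset.sum_add_distrib] }
  have hβ : ∀ j u, β (Pi.single j u) = B (e j) u := by
    intro j u
    change ∑ i, B (e i) ((Pi.single j u : ι → W) i) = _
    rw [Finset.sum_eq_single j (fun i _ hi => by rw [Pi.single_eq_of_ne hi, map_zero])
      (fun hj => absurd (Finset.mem_univ j) hj), Pi.single_eq_same]
  have hβE : ∀ y, β (y - E y) ∈ I := by
    intro y
    have h1 : β y = ∑ l, ∑ p ∈ (b l).support, B (D^[p.1] (e p.2)) (b l p • y l) := by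
      change ∑ l, B (e l) (y l) = _
      refine Finset.sum_congr rfl fun l _ => ?_
      conv_lhs => rw [← hb l, Finsupp.linearCombination_apply, Finsupp.sum, map_sum,
        AddMonoidHom.finsetSum_apply]
      exact Finset.sum_congr rfl fun p _ => hB _ _ _
    have h2 : β (E y) = ∑ l, ∑ p ∈ (b l).support, B (e p.2) (F^[p.1] (b l p • y l)) := by
      simp only [E, map_sum, hβ]
    rw [map_sub, h1, h2, ← Finset.sum_sub_distrib]
    refine I.sum_mem fun l _ => ?_
    rw [← Finset.sum_sub_distrib]
    exact I.sum_mem fun p _ => hIn _ _ _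
  have hbasis : ∀ j u, B (e j) u ∈ I := by
    intro j u
    -- As `1 - E` is onto, every value of `β` is some `β (z - E z)`, which lies in `I`.
    obtain ⟨z, hz⟩ := exists_sub_eq_of_contracting (K := K) E hEsub hEb (Pi.single j u)
    rw [← hβ, ← hz]
    exact hβE z
  rw [← e.sum_repr v, map_sum, AddMonoidHom.finsetSum_apply]
  exact I.sum_mem fun j _ => by rw [hB]; exact hbasis _ _

end DiffOp

/-! ### Splitting a module at a growth bound. -/

lemma GrowthLE.neg {X : Type*} [AddCommGroup X] {ν : X → ℝ} (hν : ∀ x, ν (-x) = ν x) {f : X →+ X}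
    {s : ℝ} (h : GrowthLE ν f s) : GrowthLE ν (-f : X →+ X) s := by
  obtain ⟨C, hC, h⟩ := h
  refine ⟨C, hC, fun n x => ?_⟩
  have h1 : (-f : X →+ X)^[n] x = f^[n] x ∨ (-f : X →+ X)^[n] x = -f^[n] x := by
    induction n with
    | zero => exact Or.inl rfl
    | succ n ih =>
      rw [Function.iterate_succ_apply', Function.iterate_succ_apply', AddMonoidHom.neg_apply]
      rcases ih with ih | ih <;> rw [ih]
      · exact Or.inr rfl
      · left; rw [map_neg, neg_neg]
  have h2 : ν ((-f : X →+ X)^[n] x) = ν (f^[n] x) := by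
    rcases h1 with h1 | h1 <;> rw [h1]
    exact hν _
  rw [h2]
  exact h n x

namespace DiffOp

section

variable {K : Type*} [Field K] {d : Derivation ℤ K K}
  {V : Type*} [AddCommGroup V] [Module K V] {W : Type*} [AddCommGroup W] [Module K W]

/-- The commutator `h ↦ D' h - h D` on linear maps. -/
def commutator (D : DiffOp d V) (D' : DiffOp d W) : (V →ₗ[K] W) →+ (V →ₗ[K] W) where
  toFun h :=
    { toFun := fun v => D' (h v) - h (D v)
      map_add' := fun v w => by
        rw [map_add, map_add, map_add, map_add]
        abel
      map_smul' := fun c v => by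
        rw [D.map_smul', h.map_smul, h.map_add, h.map_smul, h.map_smul, D'.map_smul',
          RingHom.id_apply, smul_sub]
        abel }
  map_zero' := by
    ext v
    exact (congrArg (· - (0 : W)) D'.map_zero).trans (sub_zero _)
  map_add' h h' := by
    ext v
    change D' (h v + h' v) - (h (D v) + h' (D v)) = (D' (h v) - h (D v)) + (D' (h' v) - h' (D v))
    rw [show D' (h v + h' v) = D' (h v) + D' (h' v) from D'.map_add _ _]
    abel

lemma commutator_apply (D : DiffOp d V) (D' : DiffOp d W) (h : V →ₗ[K] W) (v : V) :
    commutator D D' h v = D' (h v) - h (D v) := rfl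

end

variable {K : Type*} [NontriviallyNormedField K] [IsUltrametricDist K] {d : Derivation ℤ K K}
  {V : Type*} [AddCommGroup V] [Module K V] [FiniteDimensional K V]
  {W : Type*} [AddCommGroup W] [Module K W] [FiniteDimensional K W]
  {X : Type*} [AddCommGroup X] [Module K X] [FiniteDimensional K X] {s : ℝ}

section Complete

variable [CompleteSpace K]

/-- Rank-one maps `φ ⊗ m` span the maps from `V` to `W`, and the commutator of `φ ⊗ m` is `φ ⊗ D' m
+ D.dual φ ⊗ m`. So `D'` and `-D.dual` are adjoint modulo the range, and `NoQuot.pairing_mem`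
applies. -/
lemma NoQuot.commutator_surjective (hd : IsBoundedDerivation d) (hs : 0 < s)
    (hds : GrowthLE (fun x : K => ‖x‖) d s) {D : DiffOp d V} {D' : DiffOp d W}
    (hD : D.Bdd s) (hD' : D'.NoQuot s) (h : V →ₗ[K] W) : ∃ g, commutator D D' g = h := by
  let B : W →+ Module.Dual K V →+ (V →ₗ[K] W) :=
    AddMonoidHom.mk' (fun m => AddMonoidHom.mk' (fun φ => φ.smulRight m)
      (fun φ ψ => by ext v; simp [add_smul])) (fun m m' => by ext φ v; simp)
  have hmem := hD'.pairing_mem hd hs hds B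
    (fun c m φ => by ext v; simp [B, smul_smul, mul_comm]) (-D.dual.toAddMonoidHom)
    (GrowthLE.neg coordNorm_neg (hD.dual hs.le hds)) (commutator D D').range
    (fun m φ => ⟨φ.smulRight m, by
      ext v
      change D' (φ v • m) - φ (D v) • m = φ v • D' m - (-(D.dual φ)) v • m
      rw [D'.map_smul', LinearMap.neg_apply, D.dual_apply, neg_smul, sub_smul]
      abel⟩)
  let b := Module.finBasis K V
  have hsum : h = ∑ i, B (h (b i)) (b.coord i) := by
    refine b.ext fun j => ?_
    simp only [LinearMap.sum_apply]
    rw [Finset.sum_eq_single j]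
    · simp [B]
    · intro i _ hij
      simp [B, hij.symm]
    · simp
  rw [hsum]
  exact AddSubgroup.sum_mem _ fun i _ => hmem _ _

/-- A stable subspace without quotients of growth at most `s` has a stable complement as soon as
the quotient by it has growth at most `s`. -/
theorem NoQuot.exists_isCompl (hd : IsBoundedDerivation d) (hs : 0 < s)
    (hds : GrowthLE (fun x : K => ‖x‖) d s) {D : DiffOp d V} {T : Submodule K V}
    {hT : D.Stable T} (h1 : (D.restrict T hT).NoQuot s) (h2 : (D.quotient T hT).Bdd s) :
    ∃ (S : Submodule K V) (hS : D.Stable S), IsCompl S T ∧ (D.restrict S hS).Bdd s := by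
  obtain ⟨σ, hσ⟩ := T.mkQ.exists_rightInverse_of_surjective T.range_mkQ
  replace hσ : ∀ q, T.mkQ (σ q) = q := fun q => LinearMap.congr_fun hσ q
  have hδ : ∀ q, commutator (D.quotient T hT) D σ q ∈ T := by
    intro q
    rw [← Submodule.Quotient.mk_eq_zero, ← T.mkQ_apply, commutator_apply, map_sub, hσ,
      intertwines_mkQ D T hT, hσ, sub_self]
  -- The commutator of a linear section `σ` measures its failure to be a morphism and lands in `T`.
  -- Writing it as the commutator of some `h` into `T` makes `σ - h` a section that is a morphism.
  obtain ⟨h, hh⟩ := NoQuot.commutator_surjective hd hs hds h2 h1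
    ((commutator (D.quotient T hT) D σ).codRestrict T hδ)
  let g : V ⧸ T →ₗ[K] V := σ - T.subtype ∘ₗ h
  have hg : Intertwines (D.quotient T hT) D g := by
    intro q
    have h3 := congrArg T.subtype (LinearMap.congr_fun hh q)
    change D (h q : V) - (h (D.quotient T hT q) : V) = D (σ q) - σ (D.quotient T hT q) at h3
    change σ (D.quotient T hT q) - (h (D.quotient T hT q) : V) = D (σ q - (h q : V))
    rw [show D (σ q - (h q : V)) = D (σ q) - D (h q : V) from map_sub D.toAddMonoidHom _ _]
    rw [sub_eq_sub_iff_add_eq_add] at h3 ⊢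
    rw [add_comm, ← h3]
  have hπg : ∀ q, T.mkQ (g q) = q := by
    intro q
    change T.mkQ (σ q - (h q : V)) = q
    rw [map_sub, hσ, (Submodule.Quotient.mk_eq_zero T).2 (h q).2 |> fun h => (h : T.mkQ _ = 0),
      sub_zero]
  refine ⟨LinearMap.range g, hg.stable_range, ⟨?_, ?_⟩, ?_⟩
  · rw [Submodule.disjoint_def]
    rintro _ ⟨q, rfl⟩ hq
    have h4 : T.mkQ (g q) = 0 := (Submodule.Quotient.mk_eq_zero T).2 hq
    rw [hπg] at h4
    rw [h4, map_zero]
  · rw [codisjoint_iff, eq_top_iff]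
    intro v _
    refine Submodule.mem_sup.2 ⟨g (T.mkQ v), ⟨_, rfl⟩, v - g (T.mkQ v), ?_, by abel⟩
    rw [← Submodule.Quotient.mk_eq_zero, ← T.mkQ_apply, map_sub, hπg, sub_self]
  · refine Bdd.of_surjective (intertwines_codRestrict hg hg.stable_range fun q => ⟨q, rfl⟩) ?_
      hs.le h2
    rintro ⟨_, q, rfl⟩
    exact ⟨q, rfl⟩

/-- There is a stable subspace without quotients of growth at most `s`, the quotient by which has
growth at most `s`. -/
lemma exists_noQuot (hd : IsBoundedDerivation d) (hs : 0 < s) (D : DiffOp d V) :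
    ∃ (T : Submodule K V) (hT : D.Stable T),
      (D.restrict T hT).NoQuot s ∧ (D.quotient T hT).Bdd s := by
  -- Take `T` minimal with slow quotient. If `T / T'` is slow, so is `V / T'`, being an extension of
  -- `V / T` by `T / T'`; minimality gives `T' = T`.
  obtain ⟨T, ⟨hT, hTs⟩, hmin⟩ := wellFounded_lt.has_min
    {T : Submodule K V | ∃ hT : D.Stable T, (D.quotient T hT).Bdd s}
    ⟨⊤, D.stable_top, bdd_of_subsingleton _⟩
  refine ⟨T, hT, fun T' hT' h' => ?_, hTs⟩
  have hi := intertwines_subtype D T hT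
  have hT'' := hi.stable_map hT'
  have hle : T'.map T.subtype ≤ T := T.map_subtype_le T'
  have hk1 : T' ≤ LinearMap.ker ((T'.map T.subtype).mkQ ∘ₗ T.subtype) := by
    intro x hx
    rw [LinearMap.mem_ker, LinearMap.comp_apply]
    exact (Submodule.Quotient.mk_eq_zero _).2 ⟨x, hx, rfl⟩
  have hk2 : T'.map T.subtype ≤ LinearMap.ker T.mkQ := by rwa [T.ker_mkQ]
  have hB : (D.quotient _ hT'').Bdd s := by
    refine Bdd.of_exact hd hs
      (intertwines_liftQ ((intertwines_mkQ D _ hT'').comp hi) hT' hk1)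
      (intertwines_liftQ (intertwines_mkQ D T hT) hT'' hk2) ?_ h' hTs
    rw [Submodule.ker_liftQ, Submodule.range_liftQ, T.ker_mkQ, LinearMap.range_comp,
      T.range_subtype]
  have heq : T'.map T.subtype = T := by
    by_contra hne
    exact hmin _ ⟨hT'', hB⟩ (lt_of_le_of_ne hle hne)
  rw [eq_top_iff]
  rintro ⟨x, hx⟩ -
  rw [← heq] at hx
  obtain ⟨y, hy, hyx⟩ := hx
  rwa [show (⟨x, hx⟩ : T) = y from Subtype.ext hyx.symm]

/-- Split off a slow `S` with complement `T` that has no slow quotient: `S` must vanish, so `T` is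
everything. The growth bound on `d` that the splitting requires comes from the assumed nonzero slow
quotient. -/
lemma NoSub.noQuot (hd : IsBoundedDerivation d) (hs : 0 < s) {D : DiffOp d V} (h : D.NoSub s) :
    D.NoQuot s := by
  intro N hN hNs
  by_contra hne
  have : Nontrivial (V ⧸ N) := Submodule.Quotient.nontrivial_iff.2 hne
  have hds := hNs.growthLE_derivation hs.le
  obtain ⟨T, hT, hT1, hT2⟩ := exists_noQuot hd hs D
  obtain ⟨S, hS, hST, hSs⟩ := NoQuot.exists_isCompl hd hs hds hT1 hT2
  have hTtop : T = ⊤ := by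
    rw [h S hS hSs] at hST
    exact eq_top_of_isCompl_bot hST.symm
  have h0 := hT1.eq_zero hs.le ((intertwines_mkQ D N hN).comp (intertwines_subtype D T hT)) hNs
  refine hne (eq_top_iff.2 fun v _ => ?_)
  have hv : v ∈ T := hTtop ▸ Submodule.mem_top
  exact (Submodule.Quotient.mk_eq_zero N).1 (LinearMap.congr_fun h0 ⟨v, hv⟩)

/-- By duality. A slow submodule `W` of the dual gives a morphism from `V` to the slow dual of `W`;
it vanishes, so `W = 0`. By `NoSub.noQuot` the dual has no slow quotient, whereas a slow `U` inside
`V` makes the dual of `U` one. -/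
lemma NoQuot.noSub (hd : IsBoundedDerivation d) (hs : 0 < s) {D : DiffOp d V} (h : D.NoQuot s) :
    D.NoSub s := by
  intro U hU hUs
  by_contra hne
  have : Nontrivial U := (Submodule.nontrivial_iff_ne_bot).2 hne
  have hds := hUs.growthLE_derivation hs.le
  have h1 : D.dual.NoSub s := by
    intro W hW hWs
    have hf : Intertwines D (D.dual.restrict W hW).dual
        (W.subtype.dualMap ∘ₗ Module.Dual.eval K V) := by
      intro v
      ext φ
      change φ.1 (D v) = d (φ.1 v) - D.dual φ.1 v
      rw [D.dual_apply]
      abel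
    have h0 := h.eq_zero hs.le hf (hWs.dual hs.le hds)
    rw [eq_bot_iff]
    intro φ hφ
    rw [Submodule.mem_bot]
    ext v
    exact LinearMap.congr_fun (LinearMap.congr_fun h0 v) ⟨φ, hφ⟩
  have h2 := h1.noQuot hd hs
  have hf : Intertwines D.dual (D.restrict U hU).dual U.subtype.dualMap := fun φ => rfl
  have h0 := h2.eq_zero hs.le hf (hUs.dual hs.le hds)
  refine hne (eq_bot_iff.2 fun u hu => ?_)
  have h3 : (⟨u, hu⟩ : U) = 0 := by
    refine (Module.forall_dual_apply_eq_zero_iff K _).1 fun ψ => ?_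
    obtain ⟨φ, rfl⟩ := LinearMap.dualMap_surjective_of_injective U.injective_subtype ψ
    rw [h0]; rfl
  exact congrArg Subtype.val h3

lemma noSub_iff_noQuot (hd : IsBoundedDerivation d) (hs : 0 < s) {D : DiffOp d V} :
    D.NoSub s ↔ D.NoQuot s := ⟨NoSub.noQuot hd hs, NoQuot.noSub hd hs⟩

/-- The decomposition of `(V, D)` by the growth bound `s`. -/
theorem exists_isCompl_bdd_noSub (hd : IsBoundedDerivation d) (hs : 0 < s)
    (hds : GrowthLE (fun x : K => ‖x‖) d s) (D : DiffOp d V) :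
    ∃ (S T : Submodule K V) (hS : D.Stable S) (hT : D.Stable T), IsCompl S T ∧
      (D.restrict S hS).Bdd s ∧ (D.restrict T hT).NoSub s := by
  obtain ⟨T, hT, hT1, hT2⟩ := exists_noQuot hd hs D
  obtain ⟨S, hS, hST, hSs⟩ := NoQuot.exists_isCompl hd hs hds hT1 hT2
  exact ⟨S, T, hS, hT, hST, hSs, hT1.noSub hd hs⟩

/-- Obvious for `NoQuot`, hence true by the equivalence. -/
lemma NoSub.of_surjective (hd : IsBoundedDerivation d) (hs : 0 < s) {D : DiffOp d V}
    {D' : DiffOp d W} {f : V →ₗ[K] W} (hf : Intertwines D D' f) (hsurj : Function.Surjective f)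
    (h : D.NoSub s) : D'.NoSub s := by
  rw [noSub_iff_noQuot hd hs] at h ⊢
  intro N hN hNs
  have h0 := h.eq_zero hs.le ((intertwines_mkQ D' N hN).comp hf) hNs
  rw [eq_top_iff]
  intro w _
  obtain ⟨v, rfl⟩ := hsurj w
  exact (Submodule.Quotient.mk_eq_zero N).1 (LinearMap.congr_fun h0 v)

end Complete

lemma NoSub.of_injective (hs : 0 < s) {D : DiffOp d V}
    {D' : DiffOp d W} {f : V →ₗ[K] W} (hf : Intertwines D D' f) (hinj : Function.Injective f)
    (h : D'.NoSub s) : D.NoSub s := by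
  intro N hN hNs
  have h0 := h.eq_zero hs.le (hf.comp (intertwines_subtype D N hN)) hNs
  rw [eq_bot_iff]
  intro v hv
  exact hinj ((LinearMap.congr_fun h0 ⟨v, hv⟩).trans (map_zero f).symm)

/-- A slow submodule of the middle term dies in `X`, so it comes from `V`, where it must be zero. -/
lemma NoSub.of_exact (hs : 0 < s) {D : DiffOp d V} {D' : DiffOp d W} {D'' : DiffOp d X}
    {f : V →ₗ[K] W} {g : W →ₗ[K] X} (hf : Intertwines D D' f) (hg : Intertwines D' D'' g)
    (hinj : Function.Injective f) (hfg : LinearMap.ker g = LinearMap.range f)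
    (h1 : D.NoSub s) (h2 : D''.NoSub s) : D'.NoSub s := by
  intro N hN hNs
  have h0 := h2.eq_zero hs.le (hg.comp (intertwines_subtype D' N hN)) hNs
  have hle : N ≤ LinearMap.range f := fun w hw => hfg ▸ LinearMap.congr_fun h0 ⟨w, hw⟩
  have hNs' : (D.restrict _ (hf.stable_comap hN)).Bdd s := by
    refine Bdd.of_injective (f := (f ∘ₗ (N.comap f).subtype).codRestrict N fun v => v.2)
      (intertwines_codRestrict (hf.comp (intertwines_subtype D _ _)) hN fun v => v.2) ?_ hs.le hNs
    intro v v' hv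
    exact Subtype.ext (hinj (congrArg Subtype.val hv))
  have h3 := h1 _ _ hNs'
  rw [eq_bot_iff]
  intro w hw
  obtain ⟨v, rfl⟩ := hle hw
  have hv : v ∈ N.comap f := hw
  rw [h3, Submodule.mem_bot] at hv
  rw [hv, map_zero]
  exact Submodule.zero_mem _

/-! ### Pure modules. -/

/-- All the irreducible subquotients of `(V, D)` have growth exactly `τ`. -/
structure Pure (D : DiffOp d V) (τ : ℝ) : Prop where
  bdd : ∀ s, τ < s → D.Bdd s
  noSub : ∀ s, 0 < s → s < τ → D.NoSub s

namespace Pure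

variable {τ : ℝ}

lemma of_injective (hτ : 0 ≤ τ) {D : DiffOp d V} {D' : DiffOp d W} {f : V →ₗ[K] W}
    (hf : Intertwines D D' f) (hinj : Function.Injective f) (h : D'.Pure τ) : D.Pure τ :=
  ⟨fun s hs => (h.bdd s hs).of_injective hf hinj (hτ.trans hs.le),
    fun s hs hsτ => (h.noSub s hs hsτ).of_injective hs hf hinj⟩

lemma of_surjective [CompleteSpace K] (hd : IsBoundedDerivation d) (hτ : 0 ≤ τ) {D : DiffOp d V}
    {D' : DiffOp d W} {f : V →ₗ[K] W} (hf : Intertwines D D' f) (hsurj : Function.Surjective f)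
    (h : D.Pure τ) : D'.Pure τ :=
  ⟨fun s hs => (h.bdd s hs).of_surjective hf hsurj (hτ.trans hs.le),
    fun s hs hsτ => (h.noSub s hs hsτ).of_surjective hd hs hf hsurj⟩

lemma of_exact (hd : IsBoundedDerivation d) (hτ : 0 ≤ τ) {D : DiffOp d V} {D' : DiffOp d W}
    {D'' : DiffOp d X} {f : V →ₗ[K] W} {g : W →ₗ[K] X} (hf : Intertwines D D' f)
    (hg : Intertwines D' D'' g) (hinj : Function.Injective f)
    (hfg : LinearMap.ker g = LinearMap.range f) (h1 : D.Pure τ) (h2 : D''.Pure τ) : D'.Pure τ :=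
  ⟨fun s hs => Bdd.of_exact hd (hτ.trans_lt hs) hf hg hfg (h1.bdd s hs) (h2.bdd s hs),
    fun s hs hsτ => NoSub.of_exact hs hf hg hinj hfg (h1.noSub s hs hsτ) (h2.noSub s hs hsτ)⟩

lemma of_subsingleton [Subsingleton V] (D : DiffOp d V) : D.Pure τ :=
  ⟨fun _ _ => bdd_of_subsingleton D, fun _ _ _ _ _ _ => Subsingleton.elim _ _⟩

end Pure

lemma NoSub.subsingleton {D : DiffOp d V} (hs : 0 ≤ s) (h : D.NoSub s) (h' : D.Bdd s) :
    Subsingleton V := by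
  have := h.eq_zero hs (f := LinearMap.id) (fun _ => rfl) h'
  exact ⟨fun v w => (LinearMap.congr_fun this v).trans (LinearMap.congr_fun this w).symm⟩

lemma Pure.subsingleton_of_ne {τ τ' : ℝ} (hτ : 0 ≤ τ) (hτ' : 0 ≤ τ') {D : DiffOp d V}
    (h : D.Pure τ) (h' : D.Pure τ') (hne : τ ≠ τ') : Subsingleton V := by
  wlog hlt : τ < τ' generalizing τ τ'
  · exact this hτ' hτ h' h hne.symm (lt_of_le_of_ne (not_lt.1 hlt) hne.symm)
  obtain ⟨s, hs, hs'⟩ := exists_between hlt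
  exact (h'.noSub s (hτ.trans_lt hs) hs').subsingleton (hτ.trans hs.le) (h.bdd s hs)

end DiffOp

/-! ### Spectral norms and growth bounds. -/

section SpectralNorm

variable {X : Type*} [Zero X] {ν : X → ℝ} {f : X → X}

lemma opNorm_nonneg (hν : ∀ x, 0 ≤ ν x) : 0 ≤ opNorm ν f :=
  Real.sSup_nonneg (by rintro _ ⟨x, -, rfl⟩; exact div_nonneg (hν _) (hν _))

lemma opNorm_le (hν : ∀ x, x ≠ 0 → 0 < ν x) {C : ℝ} (hC : 0 ≤ C) (h : ∀ x, ν (f x) ≤ C * ν x) :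
    opNorm ν f ≤ C := by
  refine Real.sSup_le ?_ hC
  rintro _ ⟨x, hx, rfl⟩
  exact (div_le_iff₀ (hν x hx)).2 (h x)

lemma le_opNorm (hν : ∀ x, x ≠ 0 → 0 < ν x) (hν0 : ν 0 = 0) {C : ℝ} (h : ∀ x, ν (f x) ≤ C * ν x)
    (x : X) : ν (f x) ≤ opNorm ν f * ν x := by
  by_cases hx : x = 0
  · have := h x
    rw [hx, hν0, mul_zero] at this ⊢
    exact this
  · rw [← div_le_iff₀ (hν x hx)]
    refine le_csSup ⟨C, ?_⟩ ⟨x, hx, rfl⟩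
    rintro _ ⟨y, hy, rfl⟩
    exact (div_le_iff₀ (hν y hy)).2 (h y)

lemma iterate_le {C : ℝ} (hC : 0 ≤ C) (h : ∀ x, ν (f x) ≤ C * ν x) (n : ℕ) (x : X) :
    ν (f^[n] x) ≤ C ^ n * ν x := by
  induction n with
  | zero => simp
  | succ n ih =>
    rw [Function.iterate_succ_apply', pow_succ', mul_assoc]
    exact (h _).trans (mul_le_mul_of_nonneg_left ih hC)

lemma spectralOpNorm_nonneg (hν : ∀ x, 0 ≤ ν x) : 0 ≤ spectralOpNorm ν f :=
  Real.sInf_nonneg (by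
    rintro _ ⟨i, -, rfl⟩
    exact Real.rpow_nonneg (opNorm_nonneg hν) _)

lemma spectralOpNorm_le_rpow (hν : ∀ x, 0 ≤ ν x) {n : ℕ} (hn : 1 ≤ n) :
    spectralOpNorm ν f ≤ opNorm ν (f^[n]) ^ ((1 : ℝ) / (n : ℝ)) :=
  csInf_le ⟨0, by
    rintro _ ⟨i, -, rfl⟩
    exact Real.rpow_nonneg (opNorm_nonneg hν) _⟩ ⟨n, hn, rfl⟩

/-- The constant disappears in the limit because its `n`-th root tends to `1`. -/
lemma GrowthLE.spectralOpNorm_le (hν : ∀ x, 0 ≤ ν x) (hν' : ∀ x, x ≠ 0 → 0 < ν x) {s : ℝ}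
    (hs : 0 ≤ s) (h : GrowthLE ν f s) : spectralOpNorm ν f ≤ s := by
  obtain ⟨C, hC, h⟩ := h
  have hC1 : 0 < max C 1 := by positivity
  have key : ∀ n : ℕ, 1 ≤ n → spectralOpNorm ν f ≤ (max C 1) ^ ((1 : ℝ) / (n : ℝ)) * s := by
    intro n hn
    refine (spectralOpNorm_le_rpow hν hn).trans ?_
    have h1 : opNorm ν (f^[n]) ≤ max C 1 * s ^ n := by
      refine opNorm_le hν' (by positivity) fun x => (h n x).trans ?_
      have := hν x
      gcongr
      exact le_max_left _ _
    have h2 : s = (s ^ n) ^ ((1 : ℝ) / (n : ℝ)) := by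
      rw [one_div, Real.pow_rpow_inv_natCast hs (by omega)]
    calc _ ≤ (max C 1 * s ^ n) ^ ((1 : ℝ) / (n : ℝ)) :=
          Real.rpow_le_rpow (opNorm_nonneg hν) h1 (by positivity)
      _ = _ := by rw [Real.mul_rpow hC1.le (by positivity), ← h2]
  have hlim : Filter.Tendsto (fun n : ℕ => (max C 1) ^ ((1 : ℝ) / (n : ℝ)) * s) Filter.atTop
      (nhds (1 * s)) := by
    refine Filter.Tendsto.mul_const s ?_
    have := (Real.continuousAt_const_rpow (b := 0) hC1.ne').tendsto.comp
      tendsto_one_div_atTop_nhds_zero_nat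
    rwa [Real.rpow_zero] at this
  rw [one_mul] at hlim
  exact ge_of_tendsto hlim (Filter.eventually_atTop.2 ⟨1, key⟩)

lemma growthLE_of_spectralOpNorm_lt (hν : ∀ x, 0 ≤ ν x) (hν' : ∀ x, x ≠ 0 → 0 < ν x)
    (hν0 : ν 0 = 0) {C s : ℝ} (hf : ∀ x, ν (f x) ≤ C * ν x) (h : spectralOpNorm ν f < s) :
    GrowthLE ν f s := by
  have hs : 0 < s := (spectralOpNorm_nonneg hν).trans_lt h
  obtain ⟨_, ⟨i, hi, rfl⟩, hlt⟩ := exists_lt_of_csInf_lt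
    (show {t : ℝ | ∃ i : ℕ, 1 ≤ i ∧ t = opNorm ν (f^[i]) ^ ((1 : ℝ) / (i : ℝ))}.Nonempty from
      ⟨_, 1, le_rfl, rfl⟩) h
  set A := max 1 C with hA
  have hA0 : 0 ≤ A := by positivity
  have hfA : ∀ x, ν (f x) ≤ A * ν x := fun x => (hf x).trans (by
    have := hν x; gcongr; exact le_max_right _ _)
  have hop : opNorm ν (f^[i]) ≤ s ^ i := by
    have h1 := pow_le_pow_left₀ (Real.rpow_nonneg (opNorm_nonneg hν) _) hlt.le i
    rwa [one_div, Real.rpow_inv_natCast_pow (opNorm_nonneg hν) (by omega)] at h1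
  have hfi : ∀ x, ν (f^[i] x) ≤ s ^ i * ν x := fun x =>
    (le_opNorm hν' hν0 (iterate_le hA0 hfA i) x).trans (mul_le_mul_of_nonneg_right hop (hν x))
  -- Write `n = i * q + r` with `r < i`. The `i`-th iterate has operator norm at most `s ^ i`; the
  -- constant absorbs the `r` remaining steps and the factor `s⁻¹ ^ r`.
  refine ⟨A ^ i * (max 1 s⁻¹) ^ i, by positivity, fun n x => ?_⟩
  have hx := hν x
  have hr : n % i ≤ i := (Nat.mod_lt n (by omega)).le
  have h2 : s ^ (i * (n / i)) = s ^ n * s⁻¹ ^ (n % i) := by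
    conv_rhs => rw [← Nat.mod_add_div n i, pow_add]
    rw [inv_pow]
    field_simp
    rw [Nat.add_mul_mod_self_left, Nat.mod_mod]
  calc ν (f^[n] x) = ν (f^[n % i] ((f^[i])^[n / i] x)) := by
        rw [← Function.iterate_mul, ← Function.iterate_add_apply, Nat.mod_add_div]
    _ ≤ A ^ (n % i) * ((s ^ i) ^ (n / i) * ν x) :=
        (iterate_le hA0 hfA _ _).trans
          (mul_le_mul_of_nonneg_left (iterate_le (by positivity) hfi _ _) (by positivity))
    _ = A ^ (n % i) * s⁻¹ ^ (n % i) * s ^ n * ν x := by rw [← pow_mul, h2]; ring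
    _ ≤ A ^ i * (max 1 s⁻¹) ^ i * s ^ n * ν x := by
        gcongr
        · exact le_max_left _ _
        · exact (pow_le_pow_left₀ (by positivity) (le_max_right _ _) _).trans
            (pow_le_pow_right₀ (le_max_left _ _) hr)

end SpectralNorm

/-! ### Positivity of the spectral norm of a nonzero derivation. -/

section Field

variable {K : Type*} [NontriviallyNormedField K] [IsUltrametricDist K]

lemma norm_natCast_eq_one_of_coprime {p u : ℕ} (hp : ‖(p : K)‖ < 1) (h : Nat.Coprime p u) :
    ‖(u : K)‖ = 1 := by
  refine le_antisymm (IsUltrametricDist.norm_natCast_le_one K u) (not_lt.1 fun hu => ?_)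
  have hb := Nat.gcd_eq_gcd_ab p u
  rw [h.gcd_eq_one] at hb
  have hb' : (1 : K) = p * (p.gcdA u : ℤ) + u * (p.gcdB u : ℤ) := by
    exact_mod_cast congrArg (Int.cast (R := K)) hb
  have hlt : ‖(1 : K)‖ < 1 := by
    rw [hb']
    refine (IsUltrametricDist.norm_add_le_max _ _).trans_lt (max_lt ?_ ?_) <;> rw [norm_mul]
    · exact mul_lt_one_of_nonneg_of_lt_one_left (norm_nonneg _) hp
        (IsUltrametricDist.norm_intCast_le_one K _)
    · exact mul_lt_one_of_nonneg_of_lt_one_left (norm_nonneg _) hu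
        (IsUltrametricDist.norm_intCast_le_one K _)
  rw [norm_one] at hlt
  exact lt_irrefl _ hlt

/-- If a prime `p` has norm below `1`, Legendre's formula bounds the exponent of `p` in `n!` by `n`,
and the cofactor is a unit; so `κ = ‖p‖`. Otherwise all nonzero integers have norm `1`. -/
lemma exists_pow_le_norm_factorial [CharZero K] :
    ∃ κ : ℝ, 0 < κ ∧ ∀ n : ℕ, κ ^ n ≤ ‖((n.factorial : ℕ) : K)‖ := by
  by_cases hex : ∃ p : ℕ, p.Prime ∧ ‖(p : K)‖ < 1
  · obtain ⟨p, hp, hp1⟩ := hex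
    refine ⟨‖(p : K)‖, norm_pos_iff.2 (Nat.cast_ne_zero.2 hp.ne_zero), fun n => ?_⟩
    obtain ⟨e, u, hu, hn⟩ := Nat.exists_eq_pow_mul_and_not_dvd n.factorial_ne_zero p hp.ne_one
    have he : e ≤ n := by
      have := Fact.mk hp
      have h1 : e ≤ padicValNat p n.factorial :=
        (padicValNat_dvd_iff_le n.factorial_ne_zero).1 ⟨u, hn⟩
      have h2 := sub_one_mul_padicValNat_factorial (p := p) n
      have h3 := hp.two_le
      have h4 : padicValNat p n.factorial ≤ (p - 1) * padicValNat p n.factorial :=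
        Nat.le_mul_of_pos_left _ (by omega)
      omega
    rw [hn, Nat.cast_mul, norm_mul, Nat.cast_pow, norm_pow,
      norm_natCast_eq_one_of_coprime hp1 ((hp.coprime_iff_not_dvd).2 hu), mul_one]
    exact pow_le_pow_of_le_one (norm_nonneg _) hp1.le he
  · push Not at hex
    refine ⟨1, one_pos, fun n => ?_⟩
    rw [one_pow]
    have hall : ∀ m : ℕ, m ≠ 0 → 1 ≤ ‖(m : K)‖ := by
      intro m
      induction m using Nat.recOnMul with
      | zero => intro h; exact absurd rfl h
      | one => intro _; simp
      | prime p hp => intro _; exact hex p hp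
      | mul a b ha hb =>
        intro h
        rw [Nat.cast_mul, norm_mul]
        exact one_le_mul_of_one_le_of_one_le (ha (left_ne_zero_of_mul h))
          (hb (right_ne_zero_of_mul h))
    exact hall _ n.factorial_ne_zero

lemma omega_pos [CharZero K] : 0 < omega K := by
  unfold omega
  split_ifs with h
  · exact one_pos
  · exact Real.rpow_pos_of_pos (norm_pos_iff.2 (Nat.cast_ne_zero.2 h)) _

/-- The commutator of a self-map of `K` with the multiplication by `x`. -/
def mulCommutator (x : K) (g : K → K) : K → K := fun c => x * g c - g (x * c)

/-- Iterates `[x, d ∘ g] = d ∘ [x, g] - d x * g`. At `k = 0` the truncated `k - 1` is harmless, its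
coefficient being zero. -/
lemma iterate_mulCommutator_comp (d : Derivation ℤ K K) (x : K) (g : K → K) (k : ℕ) :
    (mulCommutator x)^[k] (fun c => d (g c)) = fun c =>
      d ((mulCommutator x)^[k] g c) - k * d x * (mulCommutator x)^[k - 1] g c := by
  induction k with
  | zero => simp
  | succ k ih =>
    rw [Function.iterate_succ_apply', ih]
    funext c
    have hk : k * d x * (mulCommutator x) ((mulCommutator x)^[k - 1] g) c =
        k * d x * (mulCommutator x)^[k] g c := by
      rcases k with _ | k
      · simp
      · rw [Nat.add_sub_cancel, ← Function.iterate_succ_apply' (mulCommutator x)]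
    rw [Function.iterate_succ_apply' _ k, Nat.add_sub_cancel]
    simp only [mulCommutator, map_sub, Derivation.leibniz, smul_eq_mul] at hk ⊢
    push_cast
    linear_combination -hk

/-- In characteristic zero this recovers a power of `d x` from `d^[n]`, bounding the norm of `d^[n]`
from below. The induction uses that one more commutator kills multiplication by a scalar. -/
lemma iterate_mulCommutator_iterate (d : Derivation ℤ K K) (x : K) (n : ℕ) :
    (mulCommutator x)^[n] (d^[n]) = fun c => (-1) ^ n * (n.factorial : K) * d x ^ n * c := by
  induction n with
  | zero => funext c; simp
  | succ n ih =>
    have h0 : (mulCommutator x)^[n + 1] (d^[n]) = fun _ => 0 := by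
      rw [Function.iterate_succ_apply', ih]
      funext c
      simp only [mulCommutator]
      ring
    have h1 : (d^[n + 1] : K → K) = fun c => d (d^[n] c) := by
      funext c; rw [Function.iterate_succ_apply']
    rw [h1, iterate_mulCommutator_comp, h0, Nat.add_sub_cancel, ih]
    funext c
    rw [map_zero, Nat.factorial_succ]
    push_cast
    ring

lemma norm_iterate_mulCommutator_le (x : K) {g : K → K} {A : ℝ}
    (hg : ∀ c, ‖g c‖ ≤ A * ‖c‖) (n : ℕ) (c : K) :
    ‖(mulCommutator x)^[n] g c‖ ≤ A * ‖x‖ ^ n * ‖c‖ := by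
  induction n generalizing c with
  | zero => simpa using hg c
  | succ n ih =>
    rw [Function.iterate_succ_apply', mulCommutator, sub_eq_add_neg]
    refine (IsUltrametricDist.norm_add_le_max _ _).trans (max_le ?_ ?_)
    · rw [norm_mul]
      calc ‖x‖ * ‖(mulCommutator x)^[n] g c‖ ≤ ‖x‖ * (A * ‖x‖ ^ n * ‖c‖) := by
            gcongr; exact ih c
        _ = _ := by ring
    · rw [norm_neg]
      refine (ih _).trans_eq ?_
      rw [norm_mul]; ring

/-- A nonzero bounded derivation has positive spectral norm. -/
theorem spectralOpNorm_derivation_pos [CharZero K] {d : Derivation ℤ K K}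
    (hd : IsBoundedDerivation d) (hne : d ≠ 0) :
    0 < spectralOpNorm (fun x : K => ‖x‖) d := by
  obtain ⟨x, hx⟩ : ∃ x, d x ≠ 0 := by
    by_contra! h
    exact hne (Derivation.ext h)
  have hx0 : x ≠ 0 := by rintro rfl; exact hx (map_zero d)
  obtain ⟨C, hC⟩ := hd
  obtain ⟨κ, hκ, hfac⟩ := exists_pow_le_norm_factorial (K := K)
  have hnx : 0 < ‖x‖ := norm_pos_iff.2 hx0
  have hndx : 0 < ‖d x‖ := norm_pos_iff.2 hx
  refine lt_of_lt_of_le (show 0 < κ * (‖d x‖ / ‖x‖) by positivity) ?_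
  refine le_csInf ⟨_, 1, le_rfl, rfl⟩ ?_
  rintro _ ⟨n, hn, rfl⟩
  have hC' : ∀ c, ‖d c‖ ≤ |C| * ‖c‖ := fun c =>
    (hC c).trans (by gcongr; exact le_abs_self C)
  -- At `1` this reads `|n!| |d x| ^ n ≤ |d ^ n|_op |x| ^ n`, with no factor `2 ^ n` thanks to the
  -- ultrametric inequality.
  have h1 := norm_iterate_mulCommutator_le x (g := d^[n])
    (le_opNorm (ν := fun c : K => ‖c‖) (fun c hc => norm_pos_iff.2 hc) norm_zero
      (iterate_le (abs_nonneg C) hC' n)) n 1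
  rw [iterate_mulCommutator_iterate] at h1
  simp only [norm_mul, norm_pow, norm_neg, norm_one, one_pow, one_mul, mul_one] at h1
  have h2 : (κ * (‖d x‖ / ‖x‖)) ^ n ≤ opNorm (fun c : K => ‖c‖) (d^[n]) := by
    rw [mul_pow, div_pow, mul_div_assoc', div_le_iff₀ (by positivity)]
    exact (mul_le_mul_of_nonneg_right (hfac n) (by positivity)).trans h1
  calc κ * (‖d x‖ / ‖x‖) = ((κ * (‖d x‖ / ‖x‖)) ^ n) ^ ((1 : ℝ) / (n : ℝ)) := by
        rw [one_div, Real.pow_rpow_inv_natCast (by positivity) (by omega)]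
    _ ≤ _ := Real.rpow_le_rpow (by positivity) h2 (by positivity)

end Field

/-! ### Purity and subsidiary radii. -/

namespace DiffOp

variable {K : Type*} [NontriviallyNormedField K] [IsUltrametricDist K] {d : Derivation ℤ K K}
  {V : Type*} [AddCommGroup V] [Module K V] [FiniteDimensional K V] {s : ℝ}

lemma coordNorm_pos {v : V} (hv : v ≠ 0) : 0 < coordNorm K V v :=
  (coordNorm_nonneg _).lt_of_ne fun h => hv (coordNorm_eq_zero.1 h.symm)

lemma bdd_of_spectralOpNorm_lt (hd : IsBoundedDerivation d) {D : DiffOp d V}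
    (h : spectralOpNorm (coordNorm K V) D < s) : D.Bdd s := by
  obtain ⟨C, -, hC⟩ := exists_coordNorm_le hd D
  exact growthLE_of_spectralOpNorm_lt coordNorm_nonneg (fun _ => coordNorm_pos) coordNorm_zero hC h

lemma Bdd.spectralOpNorm_le (hs : 0 ≤ s) {D : DiffOp d V} (h : D.Bdd s) :
    spectralOpNorm (coordNorm K V) D ≤ s :=
  GrowthLE.spectralOpNorm_le coordNorm_nonneg (fun _ => coordNorm_pos) hs h

/-- The spectral norm of a nonzero differential module is at least that of the derivation. -/
lemma Bdd.spectralOpNorm_derivation_le [Nontrivial V] (hs : 0 ≤ s) {D : DiffOp d V}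
    (h : D.Bdd s) : spectralOpNorm (fun x : K => ‖x‖) d ≤ s :=
  GrowthLE.spectralOpNorm_le (ν := fun x : K => ‖x‖) (fun x => norm_nonneg x)
    (fun _ hx => norm_pos_iff.2 hx) hs (h.growthLE_derivation hs)

lemma Pure.spectralOpNorm_eq [Nontrivial V] (hd : IsBoundedDerivation d) {τ : ℝ} (hτ : 0 ≤ τ)
    {D : DiffOp d V} (h : D.Pure τ) : spectralOpNorm (coordNorm K V) D = τ := by
  refine le_antisymm (le_of_forall_gt_imp_ge_of_dense fun s hs =>
    (h.bdd s hs).spectralOpNorm_le (hτ.trans hs.le)) (not_lt.1 fun hlt => ?_)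
  obtain ⟨s, hs, hsτ⟩ := exists_between hlt
  have hs0 : 0 < s := (spectralOpNorm_nonneg coordNorm_nonneg).trans_lt hs
  exact not_subsingleton V ((h.noSub s hs0 hsτ).subsingleton hs0.le
    (bdd_of_spectralOpNorm_lt hd hs))

lemma pure_spectralOpNorm_of_simple (hd : IsBoundedDerivation d) {D : DiffOp d V}
    (hD : ∀ N : Submodule K V, D.Stable N → N = ⊥ ∨ N = ⊤) :
    D.Pure (spectralOpNorm (coordNorm K V) D) := by
  refine ⟨fun s hs => bdd_of_spectralOpNorm_lt hd hs, fun s hs0 hs N hN hNs => ?_⟩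
  refine (hD N hN).resolve_right fun htop => hs.not_ge (Bdd.spectralOpNorm_le hs0.le ?_)
  subst htop
  exact Bdd.of_surjective (intertwines_subtype D ⊤ hN) (fun v => ⟨⟨v, trivial⟩, rfl⟩) hs0.le hNs

lemma subquotient_simple {D : DiffOp d V} {A B : StableSubmodule D} (h : A ⋖ B)
    (U : Submodule K (↥B.1 ⧸ A.1.submoduleOf B.1)) (hU : (D.subquotient A B).Stable U) :
    U = ⊥ ∨ U = ⊤ := by
  have hB := intertwines_subtype D B.1 B.2
  have hQ := intertwines_mkQ (D.restrict B.1 B.2) (A.1.submoduleOf B.1) (fun v hv => A.2 v.1 hv)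
  let C : StableSubmodule D := ⟨(U.comap (A.1.submoduleOf B.1).mkQ).map B.1.subtype,
    hB.stable_map (hQ.stable_comap hU)⟩
  have hCB : C ≤ B := B.1.map_subtype_le _
  have hAC : A ≤ C := fun a ha => by
    refine ⟨⟨a, h.le ha⟩, ?_, rfl⟩
    have h0 : (A.1.submoduleOf B.1).mkQ ⟨a, h.le ha⟩ = 0 :=
      (Submodule.Quotient.mk_eq_zero _).2 ha
    change (A.1.submoduleOf B.1).mkQ ⟨a, h.le ha⟩ ∈ U
    rw [h0]
    exact U.zero_mem
  rcases h.eq_or_eq hAC hCB with hC | hC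
  · left
    rw [eq_bot_iff]
    intro u hu
    obtain ⟨b, rfl⟩ := (A.1.submoduleOf B.1).mkQ_surjective u
    have hb : b.1 ∈ C.1 := ⟨b, hu, rfl⟩
    rw [hC] at hb
    exact (Submodule.Quotient.mk_eq_zero _).2 hb
  · right
    rw [eq_top_iff]
    intro u _
    obtain ⟨b, rfl⟩ := (A.1.submoduleOf B.1).mkQ_surjective u
    have hb : b.1 ∈ C.1 := by rw [hC]; exact b.2
    obtain ⟨b', hb', hbb⟩ := hb
    rwa [← show b' = b from Subtype.ext hbb]

/-- Having all subsidiary generic radii equal to `r` does not depend on the Jordan-Hölder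
series. -/
theorem forall_subsidiaryRadii_iff [CharZero K] [CompleteSpace K] (hd : IsBoundedDerivation d)
    {r : ℝ} (hr : 0 < r) (D : DiffOp d V) :
    (∀ t ∈ D.subsidiaryRadii, t = r) ↔ D.Pure (omega K / r) := by
  have hω := omega_pos (K := K)
  have hτ : 0 ≤ omega K / r := by positivity
  unfold subsidiaryRadii
  set S : JHSeries D := Classical.arbitrary (JHSeries D)
  -- A factor contributes only if its multiplicity, the dimension, is nonzero.
  have hmem : ∀ t, t ∈ S.radii ↔ ∃ i : Fin S.series.length,
      Nontrivial (↥(S.series i.succ).1 ⧸ (S.series i.castSucc).1.submoduleOf (S.series i.succ).1) ∧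
        t = (D.subquotient (S.series i.castSucc) (S.series i.succ)).genericRadius := by
    intro t
    simp only [JHSeries.radii, Multiset.mem_sum, Finset.mem_univ, true_and, Multiset.mem_replicate]
    refine exists_congr fun i => and_congr_left fun _ => ?_
    rw [← Module.finrank_pos_iff (R := K), Nat.pos_iff_ne_zero]
  constructor
  · intro h
    -- Climb the series: each term extends a simple factor, pure of the given rate, by the previous
    -- term.
    have hi : ∀ i : Fin (S.series.length + 1),
        (D.restrict (S.series i).1 (S.series i).2).Pure (omega K / r) := by
      intro i
      induction i using Fin.induction with
      | zero =>
        have h0 : S.series 0 = ⊥ := S.head_eq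
        have : Subsingleton (S.series 0).1 := by
          rw [h0]; exact inferInstanceAs (Subsingleton (⊥ : Submodule K V))
        exact Pure.of_subsingleton _
      | succ i ih =>
        have hstep : S.series i.castSucc ⋖ S.series i.succ := S.series.step i
        have hle : (S.series i.castSucc).1 ≤ (S.series i.succ).1 := hstep.le
        refine Pure.of_exact hd hτ (f := Submodule.inclusion hle)
          (g := ((S.series i.castSucc).1.submoduleOf (S.series i.succ).1).mkQ)
          (D'' := D.subquotient (S.series i.castSucc) (S.series i.succ)) (fun _ => rfl)
          (fun _ => rfl) (Submodule.inclusion_injective hle) ?_ ih ?_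
        · rw [Submodule.ker_mkQ, Submodule.range_inclusion]
          rfl
        · rcases subsingleton_or_nontrivial
            (↥(S.series i.succ).1 ⧸ (S.series i.castSucc).1.submoduleOf (S.series i.succ).1)
            with hsub | hnt
          · exact Pure.of_subsingleton _
          · have h1 := h _ ((hmem _).2 ⟨i, hnt, rfl⟩)
            have h2 := pure_spectralOpNorm_of_simple hd (subquotient_simple hstep)
            have h3 : spectralOpNorm (coordNorm K _)
                (D.subquotient (S.series i.castSucc) (S.series i.succ)) = omega K / r := by
              rw [← h1, genericRadius, div_div_cancel₀ hω.ne']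
            rwa [h3] at h2
    have htop : S.series (Fin.last _) = ⊤ := S.last_eq
    have hlast := hi (Fin.last _)
    refine hlast.of_surjective hd hτ (intertwines_subtype D _ _) fun v => ⟨⟨v, ?_⟩, rfl⟩
    rw [htop]
    exact Submodule.mem_top
  · intro h t ht
    obtain ⟨i, hnt, rfl⟩ := (hmem t).1 ht
    -- Each factor is a quotient of a submodule of a pure module.
    have h1 : (D.subquotient (S.series i.castSucc) (S.series i.succ)).Pure (omega K / r) :=
      (h.of_injective hτ (intertwines_subtype D _ (S.series i.succ).2)
        (Submodule.injective_subtype _)).of_surjective hd hτ (intertwines_mkQ _ _ _)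
        (Submodule.mkQ_surjective _)
    rw [genericRadius, h1.spectralOpNorm_eq hd hτ, div_div_cancel₀ hω.ne']

end DiffOp

/-! ### Commuting operators and the common decomposition. -/

namespace DiffOp

section

variable {K : Type*} [Field K] {d d' : Derivation ℤ K K}
  {V : Type*} [AddCommGroup V] [Module K V]

/-- A subspace stable under `D` is stable under every `E` commuting with `D` if it has no nonzero
morphism to its quotient. -/
lemma Stable.of_commute {D : DiffOp d V} {E : DiffOp d' V} (hDE : ∀ v, D (E v) = E (D v))
    {N : Submodule K V} (hN : D.Stable N)
    (h : ∀ f : N →ₗ[K] V ⧸ N, Intertwines (D.restrict N hN) (D.quotient N hN) f → f = 0) :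
    E.Stable N := by
  -- Modulo `N` the term `d' c • v` vanishes, so `E` induces a `K`-linear map although it is not
  -- linear itself.
  let f : N →ₗ[K] V ⧸ N :=
    { toFun := fun v => N.mkQ (E v)
      map_add' := fun v w => by
        rw [← map_add]
        exact congrArg N.mkQ (E.map_add v w)
      map_smul' := fun c v => by
        change N.mkQ (E (c • (v : V))) = c • N.mkQ (E v)
        rw [E.map_smul', N.mkQ.map_add, N.mkQ.map_smul, N.mkQ.map_smul,
          show N.mkQ (v : V) = 0 from (Submodule.Quotient.mk_eq_zero N).2 v.2, smul_zero, zero_add] }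
  have hf := h f fun v => by
    change N.mkQ (E (D v)) = D.quotient N hN (N.mkQ (E v))
    rw [← hDE, intertwines_mkQ D N hN]
  intro v hv
  exact (Submodule.Quotient.mk_eq_zero N).1 (LinearMap.congr_fun hf ⟨v, hv⟩)

lemma intertwines_complement (D : DiffOp d V) {S T : Submodule K V} (hS : D.Stable S)
    (hT : D.Stable T) :
    Intertwines (D.restrict S hS) (D.quotient T hT) (T.mkQ ∘ₗ S.subtype) :=
  (intertwines_mkQ D T hT).comp (intertwines_subtype D S hS)

end

lemma surjective_mkQ_comp_subtype {K V : Type*} [Field K] [AddCommGroup V] [Module K V]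
    {S T : Submodule K V} (h : Codisjoint S T) : Function.Surjective (T.mkQ ∘ₗ S.subtype) := by
  intro q
  obtain ⟨v, rfl⟩ := T.mkQ_surjective q
  have hv : v ∈ S ⊔ T := h.eq_top ▸ Submodule.mem_top
  obtain ⟨a, ha, b, hb, rfl⟩ := Submodule.mem_sup.1 hv
  refine ⟨⟨a, ha⟩, ?_⟩
  rw [map_add, show T.mkQ b = 0 from (Submodule.Quotient.mk_eq_zero T).2 hb, add_zero]
  rfl

end DiffOp

section Family

variable {K : Type*} [NontriviallyNormedField K] [IsUltrametricDist K] [CompleteSpace K]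
  {d d' : Derivation ℤ K K} {V : Type*} [AddCommGroup V] [Module K V] [FiniteDimensional K V]

/-- The decomposition by a growth bound is respected by commuting operators. -/
lemma DiffOp.stable_of_commute_of_isCompl (hd : IsBoundedDerivation d) {s : ℝ} (hs : 0 < s)
    {D : DiffOp d V} {E : DiffOp d' V} (hDE : ∀ v, D (E v) = E (D v)) {S T : Submodule K V}
    {hS : D.Stable S} {hT : D.Stable T} (hST : IsCompl S T) (h1 : (D.restrict S hS).Bdd s)
    (h2 : (D.restrict T hT).NoSub s) : E.Stable S ∧ E.Stable T := by
  constructor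
  · refine hS.of_commute hDE fun f hf => ?_
    exact (h2.of_surjective hd hs (intertwines_complement D hT hS)
      (surjective_mkQ_comp_subtype hST.symm.codisjoint)).eq_zero hs.le hf h1
  · refine hT.of_commute hDE fun f hf => ?_
    exact (h2.noQuot hd hs).eq_zero hs.le hf (h1.of_surjective (intertwines_complement D hS hT)
      (surjective_mkQ_comp_subtype hST.codisjoint) hs.le)

/-- The sum is an extension of a quotient of `N'` by `N`. -/
lemma DiffOp.Pure.sup (hd : IsBoundedDerivation d) {τ : ℝ} (hτ : 0 ≤ τ) {D : DiffOp d V}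
    {N N' : Submodule K V} {hN : D.Stable N} {hN' : D.Stable N'}
    (h : (D.restrict N hN).Pure τ) (h' : (D.restrict N' hN').Pure τ) :
    (D.restrict (N ⊔ N') (hN.sup hN')).Pure τ := by
  have hst : (D.restrict (N ⊔ N') (hN.sup hN')).Stable (N.submoduleOf (N ⊔ N')) :=
    fun v hv => hN v.1 hv
  have hi : Intertwines (D.restrict N' hN') (D.restrict (N ⊔ N') (hN.sup hN'))
      (Submodule.inclusion le_sup_right) := fun _ => rfl
  refine Pure.of_exact hd hτ (f := Submodule.inclusion le_sup_left) (fun _ => rfl)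
    (intertwines_mkQ _ _ hst) (Submodule.inclusion_injective le_sup_left) ?_ h
    (h'.of_surjective hd hτ ((intertwines_mkQ _ _ hst).comp hi) ?_)
  · rw [Submodule.ker_mkQ, Submodule.range_inclusion]
    rfl
  · intro q
    obtain ⟨⟨v, hv⟩, rfl⟩ := (N.submoduleOf (N ⊔ N')).mkQ_surjective q
    obtain ⟨a, ha, b, hb, rfl⟩ := Submodule.mem_sup.1 hv
    refine ⟨⟨b, hb⟩, (Submodule.Quotient.eq _).2 ?_⟩
    change b - (a + b) ∈ N
    rw [sub_add_cancel_right]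
    exact N.neg_mem ha

variable [CharZero K] {J : Type*} {δ : J → Derivation ℤ K K}

lemma isPure_iff (hd : ∀ j, IsBoundedDerivation (δ j)) (D : ∀ j, DiffOp (δ j) V) {r : J → ℝ}
    (hr : ∀ j, 0 < r j) (N : Submodule K V) :
    IsPure D r N ↔ ∀ j, ∃ hN : (D j).Stable N, ((D j).restrict N hN).Pure (omega K / r j) :=
  forall_congr' fun j => exists_congr fun _ => forall_subsidiaryRadii_iff (hd j) (hr j) _

lemma omega_div_nonneg {t : ℝ} (ht : 0 < t) : 0 ≤ omega K / t :=
  (div_pos omega_pos ht).le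

/-- Pure subspaces are closed under finite sums, and in a Noetherian lattice a nonempty such family
contains its supremum. -/
lemma isPure_component (hd : ∀ j, IsBoundedDerivation (δ j)) (D : ∀ j, DiffOp (δ j) V)
    {r : J → ℝ} (hr : ∀ j, 0 < r j) : IsPure D r (component D r) := by
  refine CompleteLattice.WellFoundedGT.isSupClosedCompact (Submodule K V) inferInstance
    {N | IsPure D r N} ⟨⊥, ?_⟩ ?_
  · exact (isPure_iff hd D hr _).2 fun j => ⟨(D j).stable_bot, Pure.of_subsingleton _⟩
  · intro N hN N' hN'
    refine (isPure_iff hd D hr _).2 fun j => ?_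
    obtain ⟨h1, h2⟩ := (isPure_iff hd D hr _).1 hN j
    obtain ⟨h3, h4⟩ := (isPure_iff hd D hr _).1 hN' j
    exact ⟨h1.sup h3, h2.sup (hd j) (omega_div_nonneg (hr j)) h4⟩

lemma le_component {D : ∀ j, DiffOp (δ j) V} {r : J → ℝ} {N : Submodule K V}
    (h : IsPure D r N) : N ≤ component D r := le_sSup h

lemma map_component_le (hd : ∀ j, IsBoundedDerivation (δ j)) (D : ∀ j, DiffOp (δ j) V)
    {r : J → ℝ} (hr : ∀ j, 0 < r j) {S : Submodule K V} (hS : ∀ j, (D j).Stable S) :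
    (component (fun j => (D j).restrict S (hS j)) r).map S.subtype ≤ component D r := by
  refine le_component ((isPure_iff hd D hr _).2 fun j => ?_)
  obtain ⟨h1, h2⟩ := (isPure_iff hd _ hr _).1
    (isPure_component hd (fun j => (D j).restrict S (hS j)) hr) j
  have hi := intertwines_subtype (D j) S (hS j)
  refine ⟨hi.stable_map h1, h2.of_surjective (hd j) (omega_div_nonneg (hr j))
    (intertwines_codRestrict (hi.comp (intertwines_subtype _ _ h1)) (hi.stable_map h1)
      fun v => ⟨v.1, v.2, rfl⟩) ?_⟩
  rintro ⟨_, v, hv, rfl⟩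
  exact ⟨⟨v, hv⟩, rfl⟩

lemma component_stable (hd : ∀ j, IsBoundedDerivation (δ j)) (D : ∀ j, DiffOp (δ j) V)
    {r : J → ℝ} (hr : ∀ j, 0 < r j) (j : J) : (D j).Stable (component D r) :=
  (isPure_component hd D hr j).1

/-- The components span. -/
theorem iSup_component_eq_top (hd : ∀ j, IsBoundedDerivation (δ j)) (hne : ∀ j, δ j ≠ 0)
    (D : ∀ j, DiffOp (δ j) V) (hD : ∀ i j v, D i (D j v) = D j (D i v)) :
    ⨆ r : (j : J) → Set.Ioc (0 : ℝ) (fieldRadius (δ j)), component D (fun j => (r j : ℝ)) = ⊤ := by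
  induction hn : Module.finrank K V using Nat.strong_induction_on generalizing V with
  | _ n ih =>
  rcases subsingleton_or_nontrivial V with hV | hV
  · exact Subsingleton.elim _ _
  -- Either some `D j` and some rate `s` cut `V` into two proper pieces, both handled by induction,
  -- or `V` is already pure for every `j`.
  by_cases hex : ∃ (j : J) (s : ℝ), 0 < s ∧ GrowthLE (fun x : K => ‖x‖) (δ j) s ∧
      ¬ (D j).Bdd s ∧ ¬ (D j).NoSub s
  · obtain ⟨j, s, hs, hds, h1, h2⟩ := hex
    obtain ⟨S, T, hS, hT, hST, hSs, hTs⟩ := exists_isCompl_bdd_noSub (hd j) hs hds (D j)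
    have hstab := fun i => stable_of_commute_of_isCompl (hd j) hs (hD j i) hST hSs hTs
    have hSne : S ≠ ⊤ := by
      rintro rfl
      exact h1 (hSs.of_surjective (intertwines_subtype (D j) ⊤ hS)
        (fun v => ⟨⟨v, Submodule.mem_top⟩, rfl⟩) hs.le)
    have hTne : T ≠ ⊤ := by
      rintro rfl
      exact h2 (hTs.of_surjective (hd j) hs (intertwines_subtype (D j) ⊤ hT)
        (fun v => ⟨⟨v, Submodule.mem_top⟩, rfl⟩))
    have key : ∀ (U : Submodule K V), U ≠ ⊤ → (∀ i, (D i).Stable U) →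
        U ≤ ⨆ r : (j : J) → Set.Ioc (0 : ℝ) (fieldRadius (δ j)),
          component D (fun j => (r j : ℝ)) := by
      intro U hU hUst
      have h3 := ih (Module.finrank K U) (hn ▸ Submodule.finrank_lt hU)
        (fun i => (D i).restrict U (hUst i))
        (fun i k v => Subtype.ext (hD i k v)) rfl
      calc U = (⊤ : Submodule K U).map U.subtype := by rw [Submodule.map_top, U.range_subtype]
        _ ≤ _ := by
          rw [← h3, Submodule.map_iSup]
          exact iSup_mono fun r => map_component_le hd D (fun j => (r j).2.1) hUst
    rw [eq_top_iff, ← hST.sup_eq_top]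
    exact sup_le (key S hSne fun i => (hstab i).1) (key T hTne fun i => (hstab i).2)
  · push Not at hex
    let τ : J → ℝ := fun j => spectralOpNorm (coordNorm K V) (D j)
    have hτσ : ∀ j, spectralOpNorm (fun x : K => ‖x‖) (δ j) ≤ τ j := fun j =>
      le_of_forall_gt_imp_ge_of_dense fun s hs =>
        (bdd_of_spectralOpNorm_lt (hd j) hs).spectralOpNorm_derivation_le
          ((spectralOpNorm_nonneg coordNorm_nonneg).trans hs.le)
    have hσ : ∀ j, 0 < spectralOpNorm (fun x : K => ‖x‖) (δ j) := fun j =>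
      spectralOpNorm_derivation_pos (hd j) (hne j)
    have hτ : ∀ j, 0 < τ j := fun j => (hσ j).trans_le (hτσ j)
    have hpure : ∀ j, (D j).Pure (τ j) := by
      intro j
      refine ⟨fun s hs => bdd_of_spectralOpNorm_lt (hd j) hs, fun s hs0 hs => ?_⟩
      by_contra hno
      have hno' := hno
      unfold NoSub at hno'
      push Not at hno'
      obtain ⟨N, hN, hNs, hNne⟩ := hno'
      have : Nontrivial N := (Submodule.nontrivial_iff_ne_bot).2 hNne
      -- A nonzero slow submodule bounds the growth of `δ j` by `s`, so the absence of a cut at `s`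
      -- leaves only `Bdd s`, impossible for `s < τ j`.
      refine hno (hex j s hs0 (hNs.growthLE_derivation hs0.le) fun hb => ?_)
      exact hs.not_ge (hb.spectralOpNorm_le hs0.le)
    -- The upper bound is `|δ j|_sp ≤ τ j`; positivity of both norms rules out the default value of
    -- division by zero.
    let r : (j : J) → Set.Ioc (0 : ℝ) (fieldRadius (δ j)) := fun j =>
      ⟨omega K / τ j, div_pos omega_pos (hτ j),
        div_le_div_of_nonneg_left omega_pos.le (hσ j) (hτσ j)⟩
    refine eq_top_iff.2 (le_trans (le_component (r := fun j => (r j : ℝ)) ?_)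
      (le_iSup (fun r : (j : J) → Set.Ioc (0 : ℝ) (fieldRadius (δ j)) =>
        component D (fun j => (r j : ℝ))) r))
    refine (isPure_iff hd D (fun j => (r j).2.1) _).2 fun j => ⟨(D j).stable_top, ?_⟩
    rw [show omega K / (r j : ℝ) = τ j from div_div_cancel₀ omega_pos.ne']
    exact (hpure j).of_injective (hτ j).le (intertwines_subtype _ _ _)
      (Submodule.injective_subtype _)

/-- The components are independent. -/
theorem iSupIndep_component (hd : ∀ j, IsBoundedDerivation (δ j)) (D : ∀ j, DiffOp (δ j) V) :
    iSupIndep fun r : (j : J) → Set.Ioc (0 : ℝ) (fieldRadius (δ j)) =>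
      component D (fun j => (r j : ℝ)) := by
  classical
  intro r
  have hpos : ∀ (r : (j : J) → Set.Ioc (0 : ℝ) (fieldRadius (δ j))) j, (0 : ℝ) < r j :=
    fun r j => (r j).2.1
  have key : ∀ F : Finset {r' : (j : J) → Set.Ioc (0 : ℝ) (fieldRadius (δ j)) // r' ≠ r},
      (∀ j, (D j).Stable (F.sup fun r' => component D (fun j => (r'.1 j : ℝ)))) ∧
      Disjoint (component D (fun j => (r j : ℝ)))
        (F.sup fun r' => component D (fun j => (r'.1 j : ℝ))) := by
    intro F
    induction F using Finset.induction_on with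
    | empty => exact ⟨fun j => (D j).stable_bot, disjoint_bot_right⟩
    | insert q F hq ih =>
      obtain ⟨hst, hdisj⟩ := ih
      rw [Finset.sup_insert]
      set W := F.sup fun r' => component D (fun j => (r'.1 j : ℝ))
      set P := component D (fun j => (q.1 j : ℝ))
      set U := component D (fun j => (r j : ℝ))
      have hPst := component_stable hd D (hpos q.1)
      have hUst := component_stable hd D (hpos r)
      refine ⟨fun j => (hPst j).sup (hst j), ?_⟩
      obtain ⟨j, hj⟩ : ∃ j, q.1 j ≠ r j := Function.ne_iff.1 q.2
      obtain ⟨_, hPp⟩ := (isPure_iff hd D (hpos q.1) _).1 (isPure_component hd D (hpos q.1)) j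
      obtain ⟨_, hUp⟩ := (isPure_iff hd D (hpos r) _).1 (isPure_component hd D (hpos r)) j
      have hq0 := omega_div_nonneg (K := K) (hpos q.1 j)
      have hr0 := omega_div_nonneg (K := K) (hpos r j)
      -- Since `U ∩ W = 0`, the intersection `U ∩ (P + W)` embeds modulo `W` into the image of `P`.
      -- For the chosen `j` it is thus pure of two different rates, hence zero.
      have hI := (hUst j).inf ((hPst j).sup (hst j))
      have h1 : ((D j).restrict _ hI).Pure (omega K / r j) :=
        hUp.of_injective hr0 (f := Submodule.inclusion inf_le_left) (fun _ => rfl)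
          (Submodule.inclusion_injective _)
      have hPW := intertwines_complement (D j) (hPst j) (hst j)
      have hR : (((D j).quotient W (hst j)).restrict _ hPW.stable_range).Pure
          (omega K / (q.1 j : ℝ)) :=
        hPp.of_surjective (hd j) hq0
          (intertwines_codRestrict hPW hPW.stable_range fun v => ⟨v, rfl⟩)
          (by rintro ⟨_, v, rfl⟩; exact ⟨v, rfl⟩)
      have hmem : ∀ v : ↥(U ⊓ (P ⊔ W)), (W.mkQ ∘ₗ (U ⊓ (P ⊔ W)).subtype) v ∈
          LinearMap.range (W.mkQ ∘ₗ P.subtype) := by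
        rintro ⟨v, hvU, hv⟩
        obtain ⟨a, ha, b, hb, rfl⟩ := Submodule.mem_sup.1 hv
        refine ⟨⟨a, ha⟩, ?_⟩
        change W.mkQ a = W.mkQ (a + b)
        rw [map_add, show W.mkQ b = 0 from (Submodule.Quotient.mk_eq_zero W).2 hb, add_zero]
      have h2 : ((D j).restrict _ hI).Pure (omega K / (q.1 j : ℝ)) := by
        refine hR.of_injective hq0 (intertwines_codRestrict
          (intertwines_complement (D j) hI (hst j)) hPW.stable_range hmem) ?_
        rw [← LinearMap.ker_eq_bot, LinearMap.ker_codRestrict, LinearMap.ker_eq_bot']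
        rintro ⟨v, hvU, hv⟩ hv0
        have hvW : v ∈ W := (Submodule.Quotient.mk_eq_zero W).1 hv0
        exact Subtype.ext (Submodule.disjoint_def.1 hdisj v hvU hvW)
      have hne : omega K / (q.1 j : ℝ) ≠ omega K / r j := by
        intro h
        have h3 := congrArg (omega K / ·) h
        simp only [div_div_cancel₀ (omega_pos (K := K)).ne'] at h3
        exact hj (Subtype.ext h3)
      have hsub := Pure.subsingleton_of_ne hq0 hr0 h2 h1 hne
      rw [disjoint_iff]
      exact Submodule.subsingleton_iff_eq_bot.1 hsub
  rw [iSup_subtype', Submodule.disjoint_def]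
  intro v hv hv'
  obtain ⟨F, hF⟩ := Submodule.mem_iSup_iff_exists_finset.1 hv'
  rw [← Finset.sup_eq_iSup] at hF
  exact Submodule.disjoint_def.1 (key F).2 v hv hF

end Family

end NonarchDiff

end

open Classical in
theorem theorem1p1
    {K : Type*} [NontriviallyNormedField K] [IsUltrametricDist K] [CompleteSpace K] [CharZero K]
    {J : Type*} [Nonempty J] (d : J → Derivation ℤ K K)
    (hd_ne : ∀ j, d j ≠ 0)
    (hd_bdd : ∀ j, NonarchDiff.IsBoundedDerivation (d j))
    (hd_comm : ∀ i j x, d i (d j x) = d j (d i x))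
    {V : Type*} [AddCommGroup V] [Module K V] [FiniteDimensional K V]
    (D : ∀ j, NonarchDiff.DiffOp (d j) V)
    (hD_comm : ∀ i j v, D i (D j v) = D j (D i v)) :
    (∀ r : (j : J) → Set.Ioc (0 : ℝ) (NonarchDiff.fieldRadius (d j)),
      IsGreatest {N : Submodule K V | NonarchDiff.IsPure D (fun j => (r j : ℝ)) N}
        (NonarchDiff.component D (fun j => (r j : ℝ)))) ∧
    {r : (j : J) → Set.Ioc (0 : ℝ) (NonarchDiff.fieldRadius (d j)) |
      NonarchDiff.component D (fun j => (r j : ℝ)) ≠ ⊥}.Finite ∧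
    DirectSum.IsInternal
      (fun r : (j : J) → Set.Ioc (0 : ℝ) (NonarchDiff.fieldRadius (d j)) =>
        NonarchDiff.component D (fun j => (r j : ℝ))) := by
  have hindep := NonarchDiff.iSupIndep_component hd_bdd D
  exact ⟨fun r => ⟨NonarchDiff.isPure_component hd_bdd D fun j => (r j).2.1,
      fun N hN => NonarchDiff.le_component hN⟩,
    WellFoundedGT.finite_ne_bot_of_iSupIndep hindep,
    DirectSum.isInternal_submodule_of_iSupIndep_of_iSup_eq_top hindep
      (NonarchDiff.iSup_component_eq_top hd_bdd hd_ne D hD_comm)⟩
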